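/- **Setting.** Let $M$ be a connected oriented 3-manifold with an ideal triangulation $\mathcal T$: $M$ is obtained from $n$ oriented Euclidean 3-simplices $\sigma_1,\dots,\sigma_n$ by gluing all faces in pairs by orientation-reversing affine maps and deleting the vertices. (For example, $M$ is the interior of a compact, connected, orientable 3-manifold whose boundary is a non-empty union of tori, and all edges of $\mathcal T$ are essential.) The two edges in each of the three pairs of opposite edges of $\sigma_j$ carry the same label $z_j$, $z_j'$ or $z_j''$; from the first vertex $v_0$ of $\sigma_j=[v_0,v_1,v_2,v_3]$ the edges to $v_1,v_2,v_3$ are labelled $z_j,z_j',z_j''$. The deformation variety $\mathfrak D(\mathcal T)\subset(\mathbb C\setminus\{0\})^{3n}$ is the set of all $Z=(z_1,z_1',z_1'',\dots,z_n'')$ with $z_j(1-z_j'')=z_j'(1-z_j)=z_j''(1-z_j')=1$ for all $j$, such that for each edge of $M$ the product of the labels of all edges of the simplices which are identified to this edge is $1$. Put $\log|Z|=(\log|z_1|,\dots,\log|z_n''|)$ and $u(Z)=(1+\|\log|Z|\|^2)^{-1/2}$. Let $\xi$ be an ideal point of $\mathfrak D(\mathcal T)$, i.e. a point of the unit sphere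 $S^{3n-1}$ in the closure of $\{u(Z)\log|Z| : Z\in\mathfrak D(\mathcal T)\}$, and let $(Z_i)$ be a sequence in $\mathfrak D(\mathcal T)$ with $u(Z_i)\log|Z_i|\to\xi$ such that each shape parameter converges in $\mathbb C\cup\{\infty\}$. The coordinates of $\xi$ at each simplex form a triple $(0,x,-x)$, $(-x,0,x)$ or $(x,-x,0)$ with $x\ge0$; let $N=N(\xi)$ be the vector with the corresponding triples $(x,0,0)$, $(0,x,0)$, $(0,0,x)$ of coordinates of the quadrilaterals separating the two edges labelled $z_j$, $z_j'$, $z_j''$ respectively. Let $\widetilde M$ be the universal cover of $M$ with the lifted triangulation, on which $\pi_1(M)$ acts by deck transformations. For each $i$ let $D_i$ be a developing map for $Z_i$, given by the ideal vertices in $\mathbb C\cup\{\infty\}$ of the images of the lifted tetrahedra: each lifted tetrahedron is mapped to an ideal hyperbolic tetrahedron with the edge invariants given by $Z_i$, and the images of tetrahedra meeting in a face share this face. Let $\rho_i:\pi_1(M)\to PSL_2(\mathbb C)$ be the representation for which $D_i$ is equivariant. Let $l_{\mathbb H}(g)=\inf_{x\in\mathbb H^3} d(x,g x)$ be the hyperbolic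 translation length of $g\in PSL_2(\mathbb C)$. The dual spine of a lifted tetrahedron above $\sigma_j$ is the metric tree consisting of a closed interval whose length $k$ is the maximum of the three coordinates of $N$ at $\sigma_j$ (possibly $k=0$), with two rays $[0,\infty)$ attached at each of its ends, one ray for each ideal vertex; if $k>0$, the rays attached at the same end belong to the two vertices on the same side of the quadrilaterals with non-zero coordinate. For a face of the tetrahedron, deleting the interior of the ray to the vertex opposite to it leaves a $Y$, whose three legs correspond to the vertices of the face. If two lifted tetrahedra meet along a face, identify their two $Y$s by the isometry which takes singularity to singularity and legs to legs as prescribed by the vertices of the face. Let $\mathfrak T_N$ be the space obtained from the disjoint union of all dual spines by these identifications, with the quotient (path) pseudo-metric $d_N$, after identifying points at distance zero. Then $\pi_1(M)$ acts on $\mathfrak T_N$; let $l_N(\gamma)=\inf_{x\in\mathfrak T_N}d_N(x,\gamma x)$. **Proposition 6.6.** For each $\gamma\in\pi_1(M)$, the number $l_N(\gamma)$ is finite, the sequence $u(Z_i)\,l_{\mathbb H}(\rho_i(\gamma))$ contains a convergent subsequence, and the limit $l_\xi(\gamma)$ of any convergent subsequence satisfies $$0\le l_\xi(\gamma)\le l_N(\gamma).$$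 -/

import Mathlib

open Filter Topology
open scoped NNReal ENNReal

noncomputable section

/-! ### Ideal triangulations -/

/-- A standard 3-simplex (in barycentric coordinates) with its four vertices removed. -/
abbrev IdealSimplex : Type :=
  {t : Fin 4 → ℝ // t ∈ stdSimplex ℝ (Fin 4) ∧ ∀ v, t v ≠ 1}

/-- The affine map between ideal 3-simplices which takes the vertex `v` to the vertex `g v`. -/
def IdealSimplex.perm (g : Equiv.Perm (Fin 4)) (t : IdealSimplex) : IdealSimplex :=
  ⟨fun v => t.1 (g.symm v),
    ⟨fun _ => t.2.1.1 _, (Equiv.sum_comp g.symm t.1).trans t.2.1.2⟩,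
    fun _ => t.2.2 _⟩

/-- A coherently oriented ideal triangulation with `n` tetrahedra: `n` copies of the standard
oriented 3-simplex, together with face pairings. The face of the simplex `i` opposite to the vertex
`f` is glued to the face of the simplex `nbr i f` opposite to the vertex `gluing i f f`, and each
vertex `v ≠ f` of the former is glued to the vertex `gluing i f v` of the latter.
The permutations are odd: the simplices are oriented coherently. -/
structure IdealTriangulation (n : ℕ) where
  nbr : Fin n → Fin 4 → Fin n
  gluing : Fin n → Fin 4 → Equiv.Perm (Fin 4)
  nbr_nbr : ∀ i f, nbr (nbr i f) (gluing i f f) = i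
  gluing_nbr : ∀ i f, gluing (nbr i f) (gluing i f f) = (gluing i f)⁻¹
  ne_self : ∀ i f, ¬ (nbr i f = i ∧ gluing i f f = f)
  odd : ∀ i f, Equiv.Perm.sign (gluing i f) = -1

namespace IdealTriangulation

variable {n : ℕ} (T : IdealTriangulation n)

/-- Identification of points of the disjoint union of the ideal 3-simplices by a face pairing. -/
def FaceRel (x y : Fin n × IdealSimplex) : Prop :=
  ∃ f, x.2.1 f = 0 ∧ y = (T.nbr x.1 f, x.2.perm (T.gluing x.1 f))

/-- The ideally triangulated 3-manifold `M`: the quotient of the disjoint union of the ideal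
3-simplices by the face pairings. -/
def Manifold : Type :=
  Quotient (Relation.EqvGen.setoid T.FaceRel)

instance : TopologicalSpace T.Manifold :=
  inferInstanceAs (TopologicalSpace (Quotient (Relation.EqvGen.setoid T.FaceRel)))

/-- The characteristic map of the `i`-th ideal tetrahedron of `M`. -/
def char (i : Fin n) (t : IdealSimplex) : T.Manifold :=
  Quotient.mk (Relation.EqvGen.setoid T.FaceRel) (i, t)

/-! ### The deformation variety and its ideal points -/

/-- The edges of the disjoint union of the `n` tetrahedra. -/
abbrev TetEdge (n : ℕ) : Type := Fin n × {e : Sym2 (Fin 4) // ¬ e.IsDiag}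

/-- The identification of edges of tetrahedra by a face pairing. -/
def EdgeRel (a b : TetEdge n) : Prop :=
  ∃ f, f ∉ a.2.1 ∧ b.1 = T.nbr a.1 f ∧ b.2.1 = a.2.1.map (T.gluing a.1 f)

end IdealTriangulation

/-- The labels `0, 1, 2` of an edge of a tetrahedron stand for the edge parameters `z, z', z''`;
opposite edges have the same label. -/
def edgeLabel (e : Sym2 (Fin 4)) : Fin 3 :=
  if e = s(0, 1) ∨ e = s(2, 3) then 0
  else if e = s(0, 2) ∨ e = s(1, 3) then 1
  else 2

namespace IdealTriangulation

variable {n : ℕ} (T : IdealTriangulation n)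

open Classical in
/-- The deformation variety: all `Z = (z₁, z₁', z₁'', …, zₙ'')` with non-zero entries which satisfy
the parameter equations and, for the class of each edge, the hyperbolic gluing equation, in which
every edge of a tetrahedron in that class contributes the factor given by its label. -/
def deformationVariety : Set (Fin n × Fin 3 → ℂ) :=
  {Z | (∀ j, Z j ≠ 0) ∧
    (∀ i, Z (i, 0) * (1 - Z (i, 2)) = 1 ∧ Z (i, 1) * (1 - Z (i, 0)) = 1 ∧
      Z (i, 2) * (1 - Z (i, 1)) = 1) ∧
    ∀ e : TetEdge n,
      ∏ a ∈ Finset.univ.filter (fun a => Relation.EqvGen T.EdgeRel e a),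
        Z (a.1, edgeLabel a.2.1) = 1}

end IdealTriangulation

/-- The vector `log |Z|`. -/
def logAbs {n : ℕ} (Z : Fin n × Fin 3 → ℂ) : EuclideanSpace ℝ (Fin n × Fin 3) :=
  WithLp.toLp 2 fun j => Real.log ‖Z j‖

/-- The scaling factor `u(Z) = 1 / √(1 + ∑ (log |z|)²)`. -/
def scaleFactor {n : ℕ} (Z : Fin n × Fin 3 → ℂ) : ℝ :=
  1 / √(1 + ∑ j, (Real.log ‖Z j‖) ^ 2)

/-- The set of ideal points of the deformation variety (Bergman's logarithmic limit set): the limit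
points on the unit sphere of the image of `Z ↦ u(Z) log |Z|`. -/
def IdealTriangulation.idealPoints {n : ℕ} (T : IdealTriangulation n) :
    Set (EuclideanSpace ℝ (Fin n × Fin 3)) :=
  Metric.sphere 0 1 ∩ closure ((fun Z => scaleFactor Z • logAbs Z) '' T.deformationVariety)

/-- Strong convergence of a sequence `Z i` to `ξ`: one has `u(Z i) log |Z i| → ξ`, and
each shape parameter converges in the Riemann sphere. -/
def StronglyConverges {n : ℕ} (Z : ℕ → Fin n × Fin 3 → ℂ)
    (ξ : EuclideanSpace ℝ (Fin n × Fin 3)) : Prop :=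
  Tendsto (fun i => scaleFactor (Z i) • logAbs (Z i)) atTop (𝓝 ξ) ∧
  ∀ j, ∃ w : OnePoint ℂ, Tendsto (fun i => (Z i j : OnePoint ℂ)) atTop (𝓝 w)

/-- The solution `(q, q', q'')` of `(q'' - q', q - q'', q' - q) = (a, b, c)` with smallest entry
zero, where `a + b + c = 0`. -/
def quadTriple (a : Fin 3 → ℝ) : Fin 3 → ℝ :=
  ![0, a 2, - a 1] - fun _ => min 0 (min (a 2) (- a 1))

lemma quadTriple_zero {x : ℝ} (hx : 0 ≤ x) : quadTriple ![0, x, -x] = ![x, 0, 0] := by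
  ext i; fin_cases i <;> simp [quadTriple, hx]

lemma quadTriple_one {x : ℝ} (hx : 0 ≤ x) : quadTriple ![-x, 0, x] = ![0, x, 0] := by
  ext i; fin_cases i <;> simp [quadTriple, hx]

lemma quadTriple_two {x : ℝ} (hx : 0 ≤ x) : quadTriple ![x, -x, 0] = ![0, 0, x] := by
  ext i; fin_cases i <;> simp [quadTriple, hx]

/-- The normal quadrilateral coordinate `N(ξ)` of an ideal point `ξ`. If `ξ` has the triple
`(0, x, -x)`, `(-x, 0, x)` or `(x, -x, 0)`, `x ≥ 0`, at a tetrahedron, then `N(ξ)` has the triple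
`(x, 0, 0)`, `(0, x, 0)` or `(0, 0, x)` respectively. The three quadrilateral types of a tetrahedron
separate the two edges with label `0`, `1`, `2` respectively. -/
def quadCoord {n : ℕ} (ξ : EuclideanSpace ℝ (Fin n × Fin 3)) (i : Fin n) : Fin 3 → ℝ :=
  quadTriple fun m => ξ (i, m)

/-! ### Dual spines -/

/-- The length `k` of the axis of the dual spine: the maximum of the three quadrilateral
coordinates. -/
def axisLength (q : Fin 3 → ℝ) : ℝ := max (q 0) (max (q 1) (q 2))

/-- The point of the axis `[0, k]` of the dual spine at which the infinite ray to the ideal vertex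
`v` is attached: when at most one of the entries of `q` is non-zero, this is `0` if `v` is on the
same side of the quadrilaterals as the vertex `0`, and it is `k` otherwise. -/
def attach (q : Fin 3 → ℝ) : Fin 4 → ℝ := ![0, q 1 + q 2, q 0 + q 2, q 0 + q 1]

/-- The points of the dual spine of a tetrahedron with quadrilateral coordinates `q`: the points of
the axis `[0, k]`, and the points at distance `r ∈ [0, ∞)` along the ray to the ideal vertex `v`.
(The initial point of a ray has distance zero to the point of the axis where it is attached.) -/
inductive Spine (q : Fin 3 → ℝ) : Type
  | axis (s : ℝ) (h₀ : 0 ≤ s) (hk : s ≤ axisLength q) : Spine q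
  | ray (v : Fin 4) (r : ℝ≥0) : Spine q

/-- The path (pseudo-)metric of the dual spine. -/
def Spine.dist {q : Fin 3 → ℝ} : Spine q → Spine q → ℝ
  | axis s _ _, axis t _ _ => |s - t|
  | axis s _ _, ray v r => |s - attach q v| + r
  | ray v r, axis s _ _ => |s - attach q v| + r
  | ray v r, ray w t => if v = w then |(r : ℝ) - t| else r + |attach q v - attach q w| + t

lemma Spine.dist_self {q : Fin 3 → ℝ} (x : Spine q) : x.dist x = 0 := by
  cases x <;> simp [Spine.dist]

lemma Spine.dist_comm {q : Fin 3 → ℝ} (x y : Spine q) : x.dist y = y.dist x := by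
  cases x with
  | axis s _ _ => cases y <;> simp [Spine.dist, abs_sub_comm]
  | ray v r =>
    cases y with
    | axis s _ _ => simp [Spine.dist]
    | ray w t =>
      by_cases h : v = w
      · simp [Spine.dist, h, abs_sub_comm]
      · have h' : ¬ w = v := fun e => h e.symm
        simp only [Spine.dist, h, h', if_false, abs_sub_comm (attach q w)]
        ring

lemma Spine.dist_nonneg {q : Fin 3 → ℝ} (x y : Spine q) : 0 ≤ x.dist y := by
  cases x <;> cases y <;> simp only [Spine.dist] <;> try split_ifs
  all_goals positivity

/-- Removing the interior of the ray to `f` from the dual spine leaves a space of the shape of a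
`Y`, corresponding to the face opposite to `f`. This is the singularity of that `Y`, as a point of
the axis: the end of the axis to which the ray to `f` is not attached. -/
def faceCentre (q : Fin 3 → ℝ) (f : Fin 4) : ℝ := axisLength q - attach q f

/-- The point `x` lies at distance `r` from the singularity of the `Y` of the face opposite to `f`,
on the leg of that `Y` which goes to the ideal vertex `w`. The leg is the (possibly degenerate)
segment of the axis from the singularity to the initial point of the ray to `w`, followed
by this ray. -/
def Spine.OnLeg {q : Fin 3 → ℝ} (f w : Fin 4) (r : ℝ) : Spine q → Prop
  | axis s _ _ => s ∈ Set.uIcc (faceCentre q f) (attach q w) ∧ r = |s - faceCentre q f|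
  | ray v t => v = w ∧ r = |attach q w - faceCentre q f| + t

/-! ### The universal cover and the tree -/

/-- The group of deck transformations of `p`; for a universal covering `p : E → M` this is the
fundamental group of `M` with its action on the universal cover. -/
def DeckGroup {E X : Type*} [TopologicalSpace E] (p : E → X) : Subgroup (E ≃ₜ E) where
  carrier := {γ | ∀ x, p (γ x) = p x}
  mul_mem' := fun {a b} ha hb x => (ha (b x)).trans (hb x)
  one_mem' := fun _ => rfl
  inv_mem' := fun {a} ha x => by
    have h := ha (a⁻¹ x)
    rw [← h]
    exact congrArg p (a.apply_symm_apply x)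

section Tree

universe u

variable {n : ℕ} (T : IdealTriangulation n) {E : Type u} [TopologicalSpace E] (p : E → T.Manifold)

/-- The ideal tetrahedra of the lifted triangulation of the covering space `E` of `M`: the lifts of
the characteristic maps of the ideal tetrahedra of `M`. -/
@[ext] structure LiftedTet where
  idx : Fin n
  map : C(IdealSimplex, E)
  lifts : ∀ t, p (map t) = T.char idx t

variable {T p}

/-- The ideal tetrahedron `τ` of the covering space is glued to `σ` along the face of `σ` opposite
to the vertex `f`. -/
def LiftedTet.Adj (σ : LiftedTet T p) (f : Fin 4) (τ : LiftedTet T p) : Prop :=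
  τ.idx = T.nbr σ.idx f ∧
    ∀ t : IdealSimplex, t.1 f = 0 → τ.map (t.perm (T.gluing σ.idx f)) = σ.map t

/-- Deck transformations permute the ideal tetrahedra of the covering space. -/
def LiftedTet.deck (γ : DeckGroup p) (σ : LiftedTet T p) : LiftedTet T p where
  idx := σ.idx
  map := ⟨fun t => γ.1 (σ.map t), γ.1.continuous.comp σ.map.continuous⟩
  lifts := fun t => (γ.2 _).trans (σ.lifts t)

variable (T p)

/-- The disjoint union of the dual spines of all ideal tetrahedra of the covering space, where the
spine of a tetrahedron above the `i`-th tetrahedron of `M` is determined by the triple `N i`. -/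
structure SpineUnion (N : Fin n → Fin 3 → ℝ) where
  tet : LiftedTet T p
  pt : Spine (N tet.idx)

variable {T p} {N : Fin n → Fin 3 → ℝ}

/-- Two points on the dual spines of ideal tetrahedra which meet along a face are identified if they
correspond to each other under the isometry of the two `Y`s belonging to the face which takes
singularity to singularity and leg to leg as prescribed by the face pairing. -/
def SpineUnion.Glued (x y : SpineUnion T p N) : Prop :=
  ∃ f, x.tet.Adj f y.tet ∧ ∃ w, w ≠ f ∧ ∃ r : ℝ,
    x.pt.OnLeg f w r ∧ y.pt.OnLeg (T.gluing x.tet.idx f f) (T.gluing x.tet.idx f w) r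

/-- Paths in the leaf space: `LeafPath x y L` says that one can move from `x` to `y` by finitely
many moves, each of which is within a dual spine or passes to an identified point, such that the
moves within the spines have total length `L`. -/
inductive SpineUnion.LeafPath : SpineUnion T p N → SpineUnion T p N → ℝ → Prop
  | nil (x) : LeafPath x x 0
  | move (σ : LiftedTet T p) (a b : Spine (N σ.idx)) {y L} :
      LeafPath ⟨σ, b⟩ y L → LeafPath ⟨σ, a⟩ y (a.dist b + L)
  | glue {x x' y L} : x.Glued x' ∨ x'.Glued x → LeafPath x' y L → LeafPath x y L

lemma SpineUnion.LeafPath.trans {x y z : SpineUnion T p N} {K L : ℝ} (h : x.LeafPath y K)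
    (h' : y.LeafPath z L) : x.LeafPath z (K + L) := by
  induction h with
  | nil x => simpa using h'
  | move σ a b _ ih => rw [add_assoc]; exact .move σ a b (ih h')
  | glue hg _ ih => exact .glue hg (ih h')

lemma SpineUnion.LeafPath.symm {x y : SpineUnion T p N} {L : ℝ} (h : x.LeafPath y L) :
    y.LeafPath x L := by
  induction h with
  | nil x => exact .nil x
  | move σ a b _ ih =>
    have := ih.trans (.move σ b a (.nil _))
    rwa [add_zero, add_comm, Spine.dist_comm] at this
  | glue hg _ ih =>
    have := ih.trans (.glue hg.symm (.nil _))
    rwa [add_zero] at this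

lemma SpineUnion.LeafPath.nonneg {x y : SpineUnion T p N} {L : ℝ} (h : x.LeafPath y L) :
    0 ≤ L := by
  induction h with
  | nil x => exact le_rfl
  | move σ a b _ ih => exact add_nonneg (Spine.dist_nonneg _ _) ih
  | glue hg _ ih => exact ih

/-- The pseudo-metric `d_N`: the infimum of the lengths of all paths (a priori, it might take the
value `∞`). -/
instance : PseudoEMetricSpace (SpineUnion T p N) where
  edist x y := ⨅ L : {L : ℝ // x.LeafPath y L}, ENNReal.ofReal L.1
  edist_self x := by
    refine le_antisymm ?_ zero_le
    exact (iInf_le _ ⟨0, .nil x⟩).trans (by simp)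
  edist_comm x y := by
    refine le_antisymm ?_ ?_ <;>
    exact le_iInf fun L => iInf_le_of_le ⟨L.1, L.2.symm⟩ le_rfl
  edist_triangle x y z := by
    rw [ENNReal.iInf_add]
    refine le_iInf fun K => ?_
    rw [ENNReal.add_iInf]
    refine le_iInf fun L => ?_
    rw [← ENNReal.ofReal_add K.2.nonneg L.2.nonneg]
    exact iInf_le_of_le ⟨K.1 + L.1, K.2.trans L.2⟩ le_rfl

variable (T p N)

/-- The tree `𝔗_N`: the leaf space of the lifted foliation, made Hausdorff by identifying points at
distance zero. -/
abbrev DualTree : Type u := SeparationQuotient (SpineUnion T p N)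

variable {T p N}

/-- The action of deck transformations on the dual spines. -/
def SpineUnion.deck (γ : DeckGroup p) (x : SpineUnion T p N) : SpineUnion T p N :=
  ⟨x.tet.deck γ, x.pt⟩

lemma SpineUnion.Glued.deck (γ : DeckGroup p) {x y : SpineUnion T p N} (h : x.Glued y) :
    (x.deck γ).Glued (y.deck γ) := by
  obtain ⟨f, ⟨h₁, h₂⟩, w, hw, r, hr⟩ := h
  exact ⟨f, ⟨h₁, fun t ht => congrArg γ.1 (h₂ t ht)⟩, w, hw, r, hr⟩

lemma SpineUnion.LeafPath.deck (γ : DeckGroup p) {x y : SpineUnion T p N} {L : ℝ}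
    (h : x.LeafPath y L) : (x.deck γ).LeafPath (y.deck γ) L := by
  induction h with
  | nil x => exact .nil _
  | move σ a b _ ih => exact .move (σ.deck γ) a b ih
  | glue hg _ ih => exact .glue (hg.imp (Glued.deck γ) (Glued.deck γ)) ih

lemma SpineUnion.lipschitz_deck (γ : DeckGroup p) :
    LipschitzWith 1 (SpineUnion.deck γ : SpineUnion T p N → SpineUnion T p N) := by
  intro x y
  rw [ENNReal.coe_one, one_mul]
  exact le_iInf fun L => iInf_le_of_le ⟨L.1, L.2.deck γ⟩ le_rfl

/-- The action of deck transformations on the tree. -/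
def DualTree.deck (γ : DeckGroup p) : DualTree T p N → DualTree T p N :=
  SeparationQuotient.lift (fun x => SeparationQuotient.mk (x.deck γ)) fun _ _ h =>
    SeparationQuotient.mk_eq_mk.2 (h.map (SpineUnion.lipschitz_deck γ).continuous)

/-- The translation length `l_N(γ)` on the tree: the infimum of `d_N(x, γ x)`. -/
def treeLength (N : Fin n → Fin 3 → ℝ) (γ : DeckGroup p) : ℝ≥0∞ :=
  ⨅ x : DualTree T p N, edist x (x.deck γ)

end Tree

/-! ### Hyperbolic space, developing maps and representations -/

/-- The points of hyperbolic 3-space in the upper half-space model. -/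
structure Hyp3 where
  z : ℂ
  t : ℝ
  pos : 0 < t

/-- The hyperbolic metric of curvature `-1`. -/
def Hyp3.dist (x y : Hyp3) : ℝ :=
  2 * Real.arsinh (√(‖x.z - y.z‖ ^ 2 + (x.t - y.t) ^ 2) / (2 * √(x.t * y.t)))

/-- The isometry of the upper half-space which extends the Möbius transformation
`z ↦ (a z + b) / (c z + d)` (Poincaré extension). -/
def Hyp3.act (g : Matrix.SpecialLinearGroup (Fin 2) ℂ) (x : Hyp3) : Hyp3 where
  z := ((g 0 0 * x.z + g 0 1) * star (g 1 0 * x.z + g 1 1) + g 0 0 * star (g 1 0) * (x.t : ℂ) ^ 2) /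
    ((‖g 1 0 * x.z + g 1 1‖ ^ 2 + ‖g 1 0‖ ^ 2 * x.t ^ 2 : ℝ) : ℂ)
  t := x.t / (‖g 1 0 * x.z + g 1 1‖ ^ 2 + ‖g 1 0‖ ^ 2 * x.t ^ 2)
  pos := by
    have hx := x.pos
    refine div_pos hx ?_
    by_cases hc : g 1 0 = 0
    · have hd : g 1 1 ≠ 0 := by
        intro hd
        have := g.det_coe
        rw [Matrix.det_fin_two, hc, hd] at this
        simp at this
      have : 0 < ‖g 1 1‖ := norm_pos_iff.2 hd
      simp only [hc, zero_mul, zero_add, norm_zero]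
      positivity
    · have : 0 < ‖g 1 0‖ := norm_pos_iff.2 hc
      positivity

/-- The group `PSL₂(ℂ)`. -/
abbrev PSL2C : Type := Matrix.ProjectiveSpecialLinearGroup (Fin 2) ℂ

/-- The hyperbolic translation length of an element of `SL₂(ℂ)`: the infimum of the distances
between `x` and its image. -/
def slLength (g : Matrix.SpecialLinearGroup (Fin 2) ℂ) : ℝ := ⨅ x : Hyp3, x.dist (x.act g)

lemma Hyp3.act_eq_of_neg {g h : Matrix.SpecialLinearGroup (Fin 2) ℂ}
    (e : ∀ i j, h i j = - g i j) (x : Hyp3) : x.act h = x.act g := by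
  have e₁ : h 1 0 * x.z + h 1 1 = -(g 1 0 * x.z + g 1 1) := by rw [e, e]; ring
  have e₀ : h 0 0 * x.z + h 0 1 = -(g 0 0 * x.z + g 0 1) := by rw [e, e]; ring
  simp only [Hyp3.act, e₁, e₀]
  simp only [norm_neg, star_neg, neg_mul_neg, e 1 0, e 0 0]

/-- The hyperbolic translation length `l_ℍ` of an element of `PSL₂(ℂ)`. -/
def hypLength : PSL2C → ℝ :=
  Quotient.lift slLength fun g h hgh => by
    rw [← Quotient.eq_iff_equiv, Quotient.eq, QuotientGroup.leftRel_apply,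
      Matrix.SpecialLinearGroup.mem_center_iff] at hgh
    obtain ⟨r, hr, hs⟩ := hgh
    have hh : ∀ i j, h i j = r * g i j := by
      intro i j
      have h₁ : (h : Matrix (Fin 2) (Fin 2) ℂ) = g.1 * (g⁻¹ * h).1 := by
        rw [← Matrix.SpecialLinearGroup.coe_mul, mul_inv_cancel_left]
      have h₂ : (h : Matrix (Fin 2) (Fin 2) ℂ) i j = (g.1 * Matrix.scalar (Fin 2) r) i j := by
        rw [hs]; exact congrFun (congrFun h₁ i) j
      rw [h₂, Matrix.scalar_apply, Matrix.mul_diagonal, mul_comm]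
    rw [Fintype.card_fin, sq_eq_one_iff] at hr
    unfold slLength
    rcases hr with hr | hr
    · have : g = h := by ext i j; rw [hh, hr, one_mul]
      rw [this]
    · refine iInf_congr fun x => ?_
      rw [Hyp3.act_eq_of_neg (g := g) (h := h) fun i j => by rw [hh, hr, neg_one_mul]]

/-- The sphere at infinity `ℂ ∪ {∞}` of hyperbolic 3-space, as the complex projective line;
`z ∈ ℂ` corresponds to the point `[z : 1]`, and `∞` corresponds to `[1 : 0]`. -/
abbrev SphereAtInfinity : Type := Projectivization ℂ (Fin 2 → ℂ)

/-- The difference `v - w` of two points of `ℂ ∪ {∞}` in homogeneous coordinates. -/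
def bracket (v w : SphereAtInfinity) : ℂ := v.rep 0 * w.rep 1 - v.rep 1 * w.rep 0

/-- The cross ratio `(a, b; c, d) = (a - c) / (a - d) * (b - d) / (b - c)` of four points of
`ℂ ∪ {∞}`. -/
def crossRatio (a b c d : SphereAtInfinity) : ℂ :=
  (bracket a c * bracket b d) / (bracket a d * bracket b c)

/-- A developing map for the point `Z` of the deformation variety, with its holonomy representation:
each ideal tetrahedron of the universal cover is mapped to the ideal hyperbolic tetrahedron with
ideal vertices `vertex σ 0, …, vertex σ 3`, which are distinct and have the edge invariants
prescribed by `Z`; tetrahedra which meet in a face are mapped such that their images share this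
face; and the map is equivariant with respect to the representation `rep`. -/
structure DevelopingMap {n : ℕ} (T : IdealTriangulation n) {E : Type*} [TopologicalSpace E]
    (p : E → T.Manifold) (Z : Fin n × Fin 3 → ℂ) where
  vertex : LiftedTet T p → Fin 4 → SphereAtInfinity
  injective : ∀ σ, Function.Injective (vertex σ)
  shape : ∀ σ,
    crossRatio (vertex σ 0) (vertex σ 1) (vertex σ 2) (vertex σ 3) = Z (σ.idx, 0) ∧
    crossRatio (vertex σ 0) (vertex σ 2) (vertex σ 3) (vertex σ 1) = Z (σ.idx, 1) ∧
    crossRatio (vertex σ 0) (vertex σ 3) (vertex σ 1) (vertex σ 2) = Z (σ.idx, 2)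
  face : ∀ σ f τ, σ.Adj f τ → ∀ w, w ≠ f → vertex τ (T.gluing σ.idx f w) = vertex σ w
  rep : DeckGroup p →* PSL2C
  equivariant : ∀ γ σ v, vertex (σ.deck γ) v = rep γ • vertex σ v

end

/-!
# Translation lengths on the dual tree bound limits of hyperbolic translation lengths

Fix a lifted tetrahedron `σ` and let its vertices under the `i`-th developing map be represented by
vectors `v₀, …, v₃` of `ℂ²`. The shape parameters are the cross ratios of the determinants
`[vⱼ, vₖ]`, so that, after rescaling the vectors, the numbers `u(Zᵢ) log |[vⱼ, vₖ]|` converge to half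
the distances in the dual spine between the attaching points of the rays to `j` and `k`
(`exists_isGauge`). Thus the images of `σ`, with the metric scaled by `u(Zᵢ) → 0`, collapse to the
dual spine.

This is made quantitative without any hyperbolic trigonometry. A basis `(a, b)` of `ℂ²` stands for a
point of `ℍ³` on the geodesic from `[b]` to `[a]`, and for two such points at distance `d`
the number `2 cosh d = ‖X⁻¹ Y‖²` (`Frame.ratio`, the Hilbert-Schmidt norm) is a sum of four terms,
each of which is a quotient of determinants. It is submultiplicative, and it bounds `exp d` from
above. For a point at distance `r` from the singularity along a leg of the `Y` of a face,
take the point at distance `r / u(Zᵢ)` along an edge of the corresponding ideal triangle, measured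
from the projection of the third ideal vertex (`legFrame`). The limits of the four terms of `2 cosh d`
are expressions in the Busemann functions of the dual spine, and the triangle inequality
`Spine.abs_attach_sub_le` shows that none of them exceeds the distance in the spine
(`growthLE_legFrame`). The point `legFrame` depends on the ideal vertices of the face only, so it is
compatible with the gluing of the `Y`s, and it is equivariant. Hence a path of length `L` in the leaf
space from `x` to `γ x` yields points of `ℍ³` which `ρᵢ(γ)` moves by at most `(L + o(1)) / u(Zᵢ)`
(`DevelopingMap.growthLE_of_leafPath`, `DevelopingMap.hypLength_le`).

Such paths exist because any two tetrahedra of the connected covering space are linked by a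
chain of tetrahedra with common faces (`LiftedTet.linked`). This gives the finiteness of the
translation length on the tree, and the boundedness of the scaled hyperbolic translation lengths.
-/

noncomputable section

/-! ### Ideal simplices -/

/-- On the standard simplex the condition `t v ≠ 1` means `t v < 1`, which is convex. -/
lemma convex_idealSimplex :
    Convex ℝ {t : Fin 4 → ℝ | t ∈ stdSimplex ℝ (Fin 4) ∧ ∀ v, t v ≠ 1} := by
  have h : {t : Fin 4 → ℝ | t ∈ stdSimplex ℝ (Fin 4) ∧ ∀ v, t v ≠ 1}
      = stdSimplex ℝ (Fin 4) ∩ ⋂ v, {t | t v < 1} := by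
    ext t
    simp only [Set.mem_ofPred_eq, Set.mem_inter_iff, Set.mem_iInter]
    refine and_congr_right fun ht => forall_congr' fun v => ?_
    have : t v ≤ 1 := ht.2 ▸ Finset.single_le_sum (fun i _ => ht.1 i) (Finset.mem_univ v)
    exact this.lt_iff_ne.symm
  rw [h]
  exact (convex_stdSimplex ℝ (Fin 4)).inter <| convex_iInter fun v =>
    convex_halfSpace_lt (LinearMap.proj v : (Fin 4 → ℝ) →ₗ[ℝ] ℝ).isLinear 1

/-- The barycentre of the face opposite to `f`. -/
def IdealSimplex.faceBarycentre (f : Fin 4) : IdealSimplex :=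
  ⟨fun v => if v = f then 0 else 1 / 3, ⟨fun v => by dsimp only; split_ifs <;> norm_num,
    by
      rw [Finset.sum_ite, Finset.filter_ne']; norm_num⟩, fun v => by
      dsimp only; split_ifs <;> norm_num⟩

lemma IdealSimplex.faceBarycentre_self (f : Fin 4) : (faceBarycentre f).1 f = 0 := if_pos rfl

instance : SimplyConnectedSpace IdealSimplex :=
  have : ContractibleSpace IdealSimplex :=
    convex_idealSimplex.contractibleSpace ⟨_, (IdealSimplex.faceBarycentre 0).2⟩
  inferInstance

instance : LocallyPathConnectedSpace IdealSimplex :=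
  convex_idealSimplex.locallyPathConnectedSpace

lemma IdealSimplex.isPreconnected_face (f : Fin 4) :
    IsPreconnected {t : IdealSimplex | t.1 f = 0} := by
  have h : Convex ℝ ({t : Fin 4 → ℝ | t ∈ stdSimplex ℝ (Fin 4) ∧ ∀ v, t v ≠ 1} ∩ {t | t f = 0}) :=
    convex_idealSimplex.inter <|
      convex_hyperplane (LinearMap.proj f : (Fin 4 → ℝ) →ₗ[ℝ] ℝ).isLinear 0
  refine IsInducing.subtypeVal.isPreconnected_image.1 ?_
  convert h.isPreconnected using 1
  ext t
  constructor
  · rintro ⟨s, hs, rfl⟩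
    exact ⟨s.2, hs⟩
  · rintro ⟨ht, hf⟩
    exact ⟨⟨t, ht⟩, hf, rfl⟩

lemma IdealSimplex.continuous_perm (g : Equiv.Perm (Fin 4)) :
    Continuous (IdealSimplex.perm g) := by
  refine Continuous.subtype_mk ?_ _
  exact continuous_pi fun v => (continuous_apply (g.symm v)).comp continuous_subtype_val

/-! ### Lifted tetrahedra -/

namespace IdealTriangulation

variable {n : ℕ} (T : IdealTriangulation n)

lemma continuous_char (i : Fin n) : Continuous (T.char i) :=
  continuous_quotient_mk'.comp (Continuous.prodMk_right i)

lemma char_face {i : Fin n} {f : Fin 4} {t : IdealSimplex} (ht : t.1 f = 0) :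
    T.char (T.nbr i f) (t.perm (T.gluing i f)) = T.char i t :=
  (Quotient.sound (Relation.EqvGen.rel (r := T.FaceRel) (i, t) _ ⟨f, ht, rfl⟩)).symm

lemma isOpen_of_char {V : Set T.Manifold} (h : ∀ i, IsOpen (T.char i ⁻¹' V)) : IsOpen V := by
  refine isOpen_coinduced.2 (isOpen_iff_mem_nhds.2 ?_)
  rintro ⟨i, t⟩ hit
  rw [nhds_prod_eq, nhds_discrete, Filter.pure_prod]
  exact Filter.mem_map.2 ((h i).mem_nhds hit)

end IdealTriangulation

section Covering

universe u

variable {n : ℕ} {T : IdealTriangulation n} {E : Type u} [TopologicalSpace E]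
  {p : E → T.Manifold}

namespace LiftedTet

/-- A lifted tetrahedron is determined by its index and the image of a single point. -/
lemma eq_of_apply_eq (hp : IsCoveringMap p) {σ τ : LiftedTet T p} (h : σ.idx = τ.idx)
    {t : IdealSimplex} (ht : σ.map t = τ.map t) : σ = τ := by
  obtain ⟨i, f, hf⟩ := σ
  obtain ⟨j, g, hg⟩ := τ
  obtain rfl : i = j := h
  have : (f : IdealSimplex → E) = g := hp.eq_of_comp_eq f.continuous g.continuous
    (funext fun s => (hf s).trans (hg s).symm) t ht
  congr
  exact DFunLike.coe_injective this

lemma exists_apply_eq (hp : IsCoveringMap p) {i : Fin n} {t : IdealSimplex} {e : E}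
    (h : p e = T.char i t) : ∃ σ : LiftedTet T p, σ.idx = i ∧ σ.map t = e := by
  obtain ⟨F, ⟨hF, hF'⟩, -⟩ :=
    hp.existsUnique_continuousMap_lifts ⟨T.char i, T.continuous_char i⟩ t e h
  exact ⟨⟨i, F, fun s => congrFun hF' s⟩, rfl, hF⟩

/-- Every face of a lifted tetrahedron is also a face of a second one. -/
lemma exists_adj (hp : IsCoveringMap p) (σ : LiftedTet T p) (f : Fin 4) :
    ∃ τ, σ.Adj f τ := by
  set g := T.gluing σ.idx f
  set b := IdealSimplex.faceBarycentre f
  have hb : b.1 f = 0 := IdealSimplex.faceBarycentre_self f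
  obtain ⟨τ, hτ, hτb⟩ := exists_apply_eq hp (i := T.nbr σ.idx f) (t := b.perm g) (e := σ.map b)
    ((σ.lifts b).trans (T.char_face hb).symm)
  refine ⟨τ, hτ, fun t ht => ?_⟩
  have h := hp.eqOn_of_comp_eqOn (g₁ := fun t => τ.map (t.perm g)) (g₂ := σ.map)
    (IdealSimplex.isPreconnected_face f)
    (τ.map.continuous.comp (IdealSimplex.continuous_perm g)).continuousOn
    σ.map.continuous.continuousOn
    (fun t ht => by
      change p (τ.map (t.perm g)) = p (σ.map t)
      rw [τ.lifts, σ.lifts, hτ]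
      exact T.char_face ht) hb hτb
  exact h ht

/-- Two lifted tetrahedra are linked if one passes from one to the other through finitely many
faces. -/
def Linked : LiftedTet T p → LiftedTet T p → Prop :=
  Relation.EqvGen fun σ τ => ∃ f, σ.Adj f τ

/-- Lifted tetrahedra with a common point are linked: the face pairings which identify the
corresponding points of the simplices lift to a chain of tetrahedra around the common point. -/
lemma linked_of_apply_eq (hp : IsCoveringMap p) {σ τ : LiftedTet T p} {t s : IdealSimplex}
    (h : σ.map t = τ.map s) : σ.Linked τ := by
  have key : ∀ x y : Fin n × IdealSimplex, Relation.EqvGen T.FaceRel x y →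
      ∀ σ τ : LiftedTet T p, σ.idx = x.1 → τ.idx = y.1 → σ.map x.2 = τ.map y.2 → σ.Linked τ := by
    intro x y hxy
    induction hxy with
    | rel x y hxy =>
      rintro σ τ hσ hτ hστ
      obtain ⟨f, hf, rfl⟩ := hxy
      obtain ⟨τ', hadj⟩ := exists_adj hp σ f
      have h₁ : τ'.idx = τ.idx := by rw [hτ, hadj.1, hσ]
      have h₂ := hadj.2 x.2 hf
      rw [hσ, hστ] at h₂
      rw [← eq_of_apply_eq hp h₁ h₂]
      exact .rel _ _ ⟨f, hadj⟩
    | refl x =>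
      rintro σ τ hσ hτ hστ
      rw [eq_of_apply_eq hp (hσ.trans hτ.symm) hστ]
      exact .refl _
    | symm x y _ ih =>
      exact fun σ τ hσ hτ hστ => .symm _ _ (ih τ σ hτ hσ hστ.symm)
    | trans x y z hxy _ ih₁ ih₂ =>
      rintro σ τ hσ hτ hστ
      have hp' : p (σ.map x.2) = T.char y.1 y.2 := by
        rw [σ.lifts, hσ]
        exact Quotient.sound hxy
      obtain ⟨ρ, hρ, hρy⟩ := exists_apply_eq hp hp'
      exact .trans _ ρ _ (ih₁ σ ρ hσ hρ hρy.symm) (ih₂ ρ τ hρ hτ (hρy.trans hστ))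
  refine key (σ.idx, t) (τ.idx, s) ?_ σ τ rfl rfl h
  refine Quotient.exact (s := Relation.EqvGen.setoid T.FaceRel) ?_
  have := congrArg p h
  rwa [σ.lifts, τ.lifts] at this

lemma exists_mem_range (hp : IsCoveringMap p) (e : E) :
    ∃ (σ : LiftedTet T p) (t : IdealSimplex), σ.map t = e := by
  obtain ⟨⟨i, t⟩, h⟩ := Quotient.exists_rep (p e)
  obtain ⟨σ, -, hσ⟩ := exists_apply_eq hp (i := i) (t := t) (e := e) h.symm
  exact ⟨σ, t, hσ⟩

/-- The covering space carries the topology which is coherent with its tetrahedra. -/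
lemma isOpen_of_preimage (hp : IsCoveringMap p) {U : Set E}
    (h : ∀ σ : LiftedTet T p, IsOpen (σ.map ⁻¹' U)) : IsOpen U := by
  refine isOpen_iff_mem_nhds.2 fun e he => ?_
  obtain ⟨S, hS, heS, hinj⟩ := hp.isLocalHomeomorph.isLocallyInjective e
  have hV : IsOpen (p '' (U ∩ S)) := by
    refine T.isOpen_of_char fun i => isOpen_iff_mem_nhds.2 fun t ht => ?_
    obtain ⟨e', he', hpe'⟩ := ht
    obtain ⟨σ, rfl, hσ⟩ := exists_apply_eq hp hpe'
    have ho : IsOpen (σ.map ⁻¹' (U ∩ S)) := (h σ).inter (hS.preimage σ.map.continuous)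
    refine Filter.mem_of_superset (ho.mem_nhds (by rw [Set.mem_preimage, hσ]; exact he')) ?_
    exact fun t' ht' => ⟨_, ht', σ.lifts t'⟩
  refine Filter.mem_of_superset
    ((hS.inter (hV.preimage hp.continuous)).mem_nhds ⟨heS, e, ⟨he, heS⟩, rfl⟩) ?_
  rintro x ⟨hxS, y, ⟨hyU, hyS⟩, hyx⟩
  rwa [← hinj hyS hxS hyx]

/-- In a connected covering space all tetrahedra are linked: the tetrahedra linked to a given one
fill a set which is open and closed. -/
lemma linked [ConnectedSpace E] (hp : IsCoveringMap p) (σ τ : LiftedTet T p) : σ.Linked τ := by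
  set U : Set E := {e | ∃ (ρ : LiftedTet T p) (t : IdealSimplex), σ.Linked ρ ∧ ρ.map t = e}
  have hU : ∀ (ρ : LiftedTet T p) (t : IdealSimplex), ρ.map t ∈ U ↔ σ.Linked ρ := fun ρ t =>
    ⟨fun ⟨_, _, h, h'⟩ => .trans _ _ _ h (linked_of_apply_eq hp h'), fun h => ⟨ρ, t, h, rfl⟩⟩
  have hclopen : IsClopen U := by
    refine ⟨⟨isOpen_of_preimage hp fun ρ => ?_⟩, isOpen_of_preimage hp fun ρ => ?_⟩
    · have : ρ.map ⁻¹' Uᶜ = {_t | ¬ σ.Linked ρ} := Set.ext fun t => not_congr (hU ρ t)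
      rw [this]; exact isOpen_const
    · have : ρ.map ⁻¹' U = {_t | σ.Linked ρ} := Set.ext fun t => hU ρ t
      rw [this]; exact isOpen_const
  have t := IdealSimplex.faceBarycentre 0
  have huniv := hclopen.eq_univ ⟨σ.map t, (hU σ t).2 (.refl σ)⟩
  exact (hU τ t).1 (huniv ▸ Set.mem_univ _)

end LiftedTet

end Covering

/-! ### Geometry of the dual spines -/

/-- A triple of quadrilateral coordinates of a single tetrahedron: at most one entry is non-zero,
and this entry is positive. -/
def IsQuadTriple (q : Fin 3 → ℝ) : Prop :=
  ∃ x : ℝ, 0 ≤ x ∧ (q = ![x, 0, 0] ∨ q = ![0, x, 0] ∨ q = ![0, 0, x])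

lemma IsQuadTriple.axisLength_nonneg {q : Fin 3 → ℝ} (hq : IsQuadTriple q) :
    0 ≤ axisLength q := by
  obtain ⟨x, hx, rfl | rfl | rfl⟩ := hq <;> simp [axisLength]

lemma IsQuadTriple.faceCentre_mem {q : Fin 3 → ℝ} (hq : IsQuadTriple q) (f : Fin 4) :
    0 ≤ faceCentre q f ∧ faceCentre q f ≤ axisLength q := by
  obtain ⟨x, hx, rfl | rfl | rfl⟩ := hq <;> fin_cases f <;>
    simp [faceCentre, axisLength, attach, hx]

/-- The singularity of the `Y` of a face lies between the attaching points of any two of its legs: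
it is the centre of the tripod spanned by the vertices of the face. -/
lemma IsQuadTriple.abs_add_abs {q : Fin 3 → ℝ} (hq : IsQuadTriple q) {f w w' : Fin 4}
    (hw : w ≠ f) (hw' : w' ≠ f) (h : w ≠ w') :
    |attach q w - faceCentre q f| + |attach q w' - faceCentre q f|
      = |attach q w - attach q w'| := by
  obtain ⟨x, hx, rfl | rfl | rfl⟩ := hq <;>
    fin_cases f <;> fin_cases w <;> fin_cases w' <;>
    simp_all [faceCentre, axisLength, attach]

namespace Spine

variable {q : Fin 3 → ℝ}

/-- The Busemann function at the ideal vertex `j` of a dual spine, normalised to vanish at the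
point where the ray to `j` is attached. -/
def busemann : Spine q → Fin 4 → ℝ
  | axis s _ _, j => |s - attach q j|
  | ray v t, j => if j = v then -(t : ℝ) else |attach q v - attach q j| + t

/-- The triangle inequality for a path to the ideal vertex `j`, through `x` and `y`, and on to
`m`. -/
lemma abs_attach_sub_le (x y : Spine q) {j m : Fin 4} (h : j ≠ m) :
    |attach q j - attach q m| ≤ x.dist y + x.busemann j + y.busemann m := by
  have tri (a b c : ℝ) : |a - c| ≤ |a - b| + |b - c| := abs_sub_le a b c
  cases x with
  | axis s _ _ =>
    cases y with
    | axis t _ _ =>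
      simp only [dist, busemann]
      rw [abs_sub_comm s (attach q j)]
      linarith [tri (attach q j) s (attach q m), tri s t (attach q m)]
    | ray v t =>
      simp only [dist, busemann]
      rw [abs_sub_comm s (attach q j)]
      split_ifs with hm
      · subst hm
        linarith [tri (attach q j) s (attach q m)]
      · linarith [tri (attach q j) s (attach q m), tri s (attach q v) (attach q m), t.coe_nonneg]
  | ray v t =>
    cases y with
    | axis s _ _ =>
      simp only [dist, busemann]
      split_ifs with hm
      · subst hm
        rw [abs_sub_comm s (attach q j)]
        linarith [tri (attach q j) s (attach q m)]
      · rw [abs_sub_comm (attach q v) (attach q j), abs_sub_comm s (attach q v)]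
        linarith [tri (attach q j) (attach q v) (attach q m), tri (attach q v) s (attach q m),
          t.coe_nonneg]
    | ray w r =>
      have h₁ := tri (attach q j) (attach q v) (attach q m)
      have h₂ := tri (attach q v) (attach q w) (attach q m)
      have ht := t.coe_nonneg
      have hr := r.coe_nonneg
      have h₃ := le_abs_self ((t : ℝ) - r)
      have h₄ := neg_abs_le ((t : ℝ) - r)
      simp only [dist, busemann]
      rw [abs_sub_comm (attach q v) (attach q j)]
      by_cases hvw : v = w
      · subst hvw
        by_cases hj : j = v
        · subst hj
          simp only [if_pos, if_neg h.symm]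
          linarith
        · by_cases hm : m = v
          · subst hm
            simp only [if_pos, if_neg hj]
            linarith
          · simp only [if_pos, if_neg hj, if_neg hm]
            linarith
      · by_cases hj : j = v
        · subst hj
          by_cases hm : m = w
          · subst hm
            simp only [if_neg hvw, if_pos]
            linarith
          · simp only [if_neg hvw, if_pos, if_neg hm]
            linarith
        · by_cases hm : m = w
          · subst hm
            simp only [if_neg hvw, if_neg hj, if_pos]
            linarith
          · simp only [if_neg hvw, if_neg hj, if_neg hm]
            linarith

/-- Along a leg, the Busemann function at its own ideal vertex decreases with unit speed. -/
lemma OnLeg.busemann_eq {f w : Fin 4} {r : ℝ} {x : Spine q} (h : x.OnLeg f w r) :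
    x.busemann w = |attach q w - faceCentre q f| - r := by
  cases x with
  | axis s _ _ =>
    obtain ⟨hs, rfl⟩ := h
    simp only [busemann]
    rcases Set.mem_uIcc.1 hs with ⟨h₁, h₂⟩ | ⟨h₁, h₂⟩
    · rw [abs_of_nonpos (by linarith), abs_of_nonneg (by linarith), abs_of_nonneg (by linarith)]
      ring
    · rw [abs_of_nonneg (by linarith), abs_of_nonpos (by linarith), abs_of_nonpos (by linarith)]
      ring
  | ray v t =>
    obtain ⟨rfl, rfl⟩ := h
    simp [busemann]

/-- Along a leg, the Busemann functions at other ideal vertices increase with at most unit speed. -/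
lemma OnLeg.busemann_le {f w w' : Fin 4} {r : ℝ} {x : Spine q} (h : x.OnLeg f w r)
    (hw : w ≠ w') : x.busemann w' ≤ r + |attach q w' - faceCentre q f| := by
  cases x with
  | axis s _ _ =>
    obtain ⟨-, rfl⟩ := h
    rw [abs_sub_comm (attach q w')]
    exact abs_sub_le _ _ _
  | ray v t =>
    obtain ⟨rfl, rfl⟩ := h
    simp only [busemann, if_neg hw.symm]
    rw [abs_sub_comm (attach q w')]
    linarith [abs_sub_le (attach q v) (faceCentre q f) (attach q w')]

/-- Every point of a dual spine lies on a leg of the `Y` of some face. -/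
lemma exists_onLeg (hq : IsQuadTriple q) (x : Spine q) :
    ∃ f w r, w ≠ f ∧ x.OnLeg f w r := by
  cases x with
  | axis s h₀ hk =>
    -- a leg which contains the whole axis
    obtain ⟨f, w, hwf, hf, hw⟩ : ∃ f w : Fin 4, w ≠ f ∧ faceCentre q f = 0 ∧
        attach q w = axisLength q := by
      obtain ⟨x, hx, rfl | rfl | rfl⟩ := hq
      · exact ⟨2, 3, by decide, by simp [faceCentre, axisLength, attach, hx]⟩
      · exact ⟨1, 3, by decide, by simp [faceCentre, axisLength, attach, hx]⟩
      · exact ⟨1, 2, by decide, by simp [faceCentre, axisLength, attach, hx]⟩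
    exact ⟨f, w, _, hwf, by rw [hf, hw]; exact Set.mem_uIcc_of_le h₀ hk, rfl⟩
  | ray v t =>
    obtain ⟨f, hf⟩ := exists_ne v
    exact ⟨f, v, _, hf.symm, rfl, rfl⟩

end Spine

/-! ### Finiteness of the translation length on the tree -/

section Tree

universe u

variable {n : ℕ} {T : IdealTriangulation n} {E : Type u} [TopologicalSpace E]
  {p : E → T.Manifold} {N : Fin n → Fin 3 → ℝ}

namespace SpineUnion

/-- A path through the singularities of the `Y`s of the common face. -/
lemma exists_leafPath_of_adj (hN : ∀ i, IsQuadTriple (N i)) {σ τ : LiftedTet T p} {f : Fin 4}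
    (h : σ.Adj f τ) (a : Spine (N σ.idx)) (b : Spine (N τ.idx)) :
    ∃ L, LeafPath (⟨σ, a⟩ : SpineUnion T p N) ⟨τ, b⟩ L := by
  obtain ⟨w, hw⟩ := exists_ne f
  set f' := T.gluing σ.idx f f
  have hc := (hN σ.idx).faceCentre_mem f
  have hc' := (hN τ.idx).faceCentre_mem f'
  refine ⟨_, .move σ a (.axis _ hc.1 hc.2) (.glue (.inl ?_)
    (.move τ (.axis _ hc'.1 hc'.2) b (.nil _)))⟩
  exact ⟨f, h, w, hw, 0, ⟨Set.left_mem_uIcc, by simp⟩, ⟨Set.left_mem_uIcc, by simp [f']⟩⟩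

lemma exists_leafPath (hN : ∀ i, IsQuadTriple (N i)) [ConnectedSpace E] (hp : IsCoveringMap p)
    (x y : SpineUnion T p N) : ∃ L, x.LeafPath y L := by
  have key : ∀ σ τ : LiftedTet T p, σ.Linked τ → ∀ (a : Spine (N σ.idx)) (b : Spine (N τ.idx)),
      ∃ L, LeafPath (⟨σ, a⟩ : SpineUnion T p N) ⟨τ, b⟩ L := by
    intro σ τ h
    induction h with
    | rel σ τ h => exact fun a b => exists_leafPath_of_adj hN h.choose_spec a b
    | refl σ => exact fun a b => ⟨_, .move σ a b (.nil _)⟩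
    | symm σ τ _ ih => exact fun a b => (ih b a).imp fun L hL => hL.symm
    | trans σ τ ρ _ _ ih₁ ih₂ =>
      intro a b
      obtain ⟨K, hK⟩ := ih₁ a (.axis 0 le_rfl (hN τ.idx).axisLength_nonneg)
      obtain ⟨L, hL⟩ := ih₂ (.axis 0 le_rfl (hN τ.idx).axisLength_nonneg) b
      exact ⟨K + L, hK.trans hL⟩
  exact key x.tet y.tet (LiftedTet.linked hp _ _) x.pt y.pt

end SpineUnion

lemma treeLength_ne_top (hN : ∀ i, IsQuadTriple (N i)) [ConnectedSpace E] (hp : IsCoveringMap p)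
    (γ : DeckGroup p) : treeLength N γ ≠ ⊤ := by
  obtain ⟨σ, -⟩ := LiftedTet.exists_mem_range hp (Classical.arbitrary E)
  set x : SpineUnion T p N := ⟨σ, .axis 0 le_rfl (hN σ.idx).axisLength_nonneg⟩
  obtain ⟨L, hL⟩ := SpineUnion.exists_leafPath hN hp x (x.deck γ)
  refine ne_top_of_le_ne_top (ENNReal.ofReal_ne_top (r := L)) ?_
  refine iInf_le_of_le (SeparationQuotient.mk x) ?_
  exact (SeparationQuotient.edist_mk x (x.deck γ)).le.trans
    (iInf_le (fun L : {L : ℝ // x.LeafPath (x.deck γ) L} => ENNReal.ofReal L.1) ⟨L, hL⟩)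

/-- The translation length on the tree is determined by the paths from the points of the dual spines
to their images. -/
lemma le_treeLength {γ : DeckGroup p} {l : ℝ}
    (h : ∀ (x : SpineUnion T p N) (L : ℝ), x.LeafPath (x.deck γ) L → l ≤ L) :
    ENNReal.ofReal l ≤ treeLength N γ := by
  refine le_iInf fun x => ?_
  obtain ⟨x, rfl⟩ := SeparationQuotient.surjective_mk x
  refine le_trans ?_ (SeparationQuotient.edist_mk x (x.deck γ)).ge
  exact le_iInf fun L => ENNReal.ofReal_le_ofReal (h x L.1 L.2)

end Tree

/-! ### Frames and points of hyperbolic space -/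

/-- The determinant of two vectors of `ℂ²`. -/
def pairing (v w : Fin 2 → ℂ) : ℂ := v 0 * w 1 - v 1 * w 0

lemma pairing_swap (v w : Fin 2 → ℂ) : pairing w v = -pairing v w := by
  simp only [pairing]; ring

lemma pairing_self (v : Fin 2 → ℂ) : pairing v v = 0 := by
  simp only [pairing]; ring

lemma pairing_smul_smul (x y : ℂ) (v w : Fin 2 → ℂ) :
    pairing (x • v) (y • w) = x * y * pairing v w := by
  simp only [pairing, Pi.smul_apply, smul_eq_mul]; ring

lemma norm_pairing_comm (v w : Fin 2 → ℂ) : ‖pairing v w‖ = ‖pairing w v‖ := by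
  rw [pairing_swap, norm_neg]

lemma pairing_mulVec (g : Matrix.SpecialLinearGroup (Fin 2) ℂ) (v w : Fin 2 → ℂ) :
    pairing (g.1.mulVec v) (g.1.mulVec w) = pairing v w := by
  have h := g.det_coe
  rw [Matrix.det_fin_two] at h
  simp only [pairing, Matrix.mulVec, dotProduct, Fin.sum_univ_two]
  linear_combination (v 0 * w 1 - v 1 * w 0) * h

lemma bracket_eq_pairing (v w : SphereAtInfinity) : bracket v w = pairing v.rep w.rep := rfl

lemma pairing_rep_ne_zero {v w : SphereAtInfinity} (h : v ≠ w) : pairing v.rep w.rep ≠ 0 := by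
  intro h₀
  refine h ?_
  rw [← v.mk_rep, ← w.mk_rep, Projectivization.mk_eq_mk_iff']
  have h₁ : v.rep 0 * w.rep 1 = v.rep 1 * w.rep 0 := sub_eq_zero.1 h₀
  have hw := w.rep_nonzero
  by_cases hw0 : w.rep 0 = 0
  · have hw1 : w.rep 1 ≠ 0 := fun hw1 => hw (by ext i; fin_cases i <;> assumption)
    refine ⟨v.rep 1 / w.rep 1, ?_⟩
    ext i
    fin_cases i
    · have h₂ : v.rep 0 = 0 := by simpa [hw0, hw1] using h₁
      simp [hw0, h₂]
    · simp [hw1]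
  · refine ⟨v.rep 0 / w.rep 0, ?_⟩
    ext i
    fin_cases i
    · simp [hw0]
    · simp only [Pi.smul_apply, smul_eq_mul, Fin.mk_one]
      field_simp
      linear_combination h₁

/-- A pair of vectors `(a, b)` of `ℂ²`. If it is a basis, then it stands for the image of the point
`j = (0, 1)` of the upper half-space under the matrix with columns `a` and `b`; this point lies on
the geodesic with the ends `[a]` and `[b]`. -/
abbrev Frame : Type := (Fin 2 → ℂ) × (Fin 2 → ℂ)

namespace Frame

/-- The determinant of a frame. -/
def det (X : Frame) : ℂ := pairing X.1 X.2

/-- The squared Hilbert-Schmidt norm of `X⁻¹ Y`, for frames `X`, `Y` normalised to have determinants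
of absolute value `1`. This is `2 cosh d` for the distance `d` of the two points of hyperbolic
space. -/
def ratio (X Y : Frame) : ℝ :=
  (‖pairing X.1 Y.1‖ ^ 2 + ‖pairing X.1 Y.2‖ ^ 2 + ‖pairing X.2 Y.1‖ ^ 2 + ‖pairing X.2 Y.2‖ ^ 2) /
    (‖X.det‖ * ‖Y.det‖)

/-- The Cauchy-Schwarz inequality combined with the Plücker relation. -/
lemma norm_pairing_sq_le (a c u v : Fin 2 → ℂ) :
    ‖pairing a c‖ ^ 2 * ‖pairing u v‖ ^ 2 ≤
      (‖pairing a u‖ ^ 2 + ‖pairing a v‖ ^ 2) * (‖pairing u c‖ ^ 2 + ‖pairing v c‖ ^ 2) := by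
  have h : pairing a c * pairing u v = pairing a v * pairing u c - pairing a u * pairing v c := by
    simp only [pairing]; ring
  have h' : ‖pairing a c‖ * ‖pairing u v‖ ≤
      ‖pairing a v‖ * ‖pairing u c‖ + ‖pairing a u‖ * ‖pairing v c‖ := by
    rw [← norm_mul, ← norm_mul, ← norm_mul, h]
    exact norm_sub_le _ _
  rw [← mul_pow]
  refine (pow_le_pow_left₀ (by positivity) h' 2).trans ?_
  nlinarith [sq_nonneg (‖pairing a u‖ * ‖pairing u c‖ - ‖pairing a v‖ * ‖pairing v c‖)]

lemma ratio_nonneg (X Y : Frame) : 0 ≤ X.ratio Y := by unfold ratio; positivity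

/-- The triangle inequality for `log ratio`. -/
lemma ratio_le_mul (X Z : Frame) {Y : Frame} (hY : Y.det ≠ 0) :
    X.ratio Z ≤ X.ratio Y * Y.ratio Z := by
  have hY' : 0 < ‖Y.det‖ := norm_pos_iff.2 hY
  have h₁₁ := norm_pairing_sq_le X.1 Z.1 Y.1 Y.2
  have h₁₂ := norm_pairing_sq_le X.1 Z.2 Y.1 Y.2
  have h₂₁ := norm_pairing_sq_le X.2 Z.1 Y.1 Y.2
  have h₂₂ := norm_pairing_sq_le X.2 Z.2 Y.1 Y.2
  change ‖_‖ ^ 2 * ‖Y.det‖ ^ 2 ≤ _ at h₁₁ h₁₂ h₂₁ h₂₂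
  unfold ratio
  rw [div_mul_div_comm, show ‖X.det‖ * ‖Y.det‖ * (‖Y.det‖ * ‖Z.det‖)
    = ‖Y.det‖ ^ 2 * (‖X.det‖ * ‖Z.det‖) by ring, ← div_div _ (‖Y.det‖ ^ 2)]
  refine div_le_div_of_nonneg_right (c := ‖X.det‖ * ‖Z.det‖) ?_ (by positivity)
  rw [le_div_iff₀ (by positivity)]
  linarith

lemma ratio_smul_right (X : Frame) (a b : Fin 2 → ℂ) {x : ℂ} (hx : x ≠ 0) :
    X.ratio (x • a, x • b) = X.ratio (a, b) := by
  have hx' : ‖x‖ ≠ 0 := norm_ne_zero_iff.2 hx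
  have h (v w : Fin 2 → ℂ) : ‖pairing v (x • w)‖ = ‖x‖ * ‖pairing v w‖ := by
    rw [← one_smul ℂ v, pairing_smul_smul, one_mul, one_smul, norm_mul]
  have h' : ‖pairing (x • a) (x • b)‖ = ‖x‖ * ‖x‖ * ‖pairing a b‖ := by
    rw [pairing_smul_smul, norm_mul, norm_mul]
  simp only [ratio, det, h', h, mul_pow]
  rw [← mul_add, ← mul_add, ← mul_add, show ‖pairing X.1 X.2‖ * (‖x‖ * ‖x‖ * ‖pairing a b‖)
    = ‖x‖ ^ 2 * (‖pairing X.1 X.2‖ * ‖pairing a b‖) by ring]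
  exact mul_div_mul_left _ _ (pow_ne_zero 2 hx')

lemma norm_sq_pos {X : Frame} (hX : X.det ≠ 0) : 0 < ‖X.1 1‖ ^ 2 + ‖X.2 1‖ ^ 2 := by
  by_contra! h
  have h₁ : X.1 1 = 0 := by
    rw [← norm_eq_zero]; nlinarith [norm_nonneg (X.1 1), sq_nonneg ‖X.2 1‖, sq_nonneg ‖X.1 1‖]
  have h₂ : X.2 1 = 0 := by
    rw [← norm_eq_zero]; nlinarith [norm_nonneg (X.2 1), sq_nonneg ‖X.2 1‖, sq_nonneg ‖X.1 1‖]
  exact hX (by simp [det, pairing, h₁, h₂])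

/-- The point of the upper half-space which is given by a frame. -/
def point (X : Frame) (hX : X.det ≠ 0) : Hyp3 where
  z := (X.1 0 * star (X.1 1) + X.2 0 * star (X.2 1)) / ((‖X.1 1‖ ^ 2 + ‖X.2 1‖ ^ 2 : ℝ) : ℂ)
  t := ‖X.det‖ / (‖X.1 1‖ ^ 2 + ‖X.2 1‖ ^ 2)
  pos := div_pos (norm_pos_iff.2 hX) (norm_sq_pos hX)

end Frame

lemma Hyp3.ext_coords {x y : Hyp3} (hz : x.z = y.z) (ht : x.t = y.t) : x = y := by
  cases x; cases y; cases hz; cases ht; rfl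

lemma Hyp3.dist_nonneg (x y : Hyp3) : 0 ≤ x.dist y :=
  mul_nonneg zero_le_two (Real.arsinh_nonneg_iff.2 (by positivity))

/-- As `2 cosh d = (‖z - z'‖² + t² + t'²) / (t t')`, the distance `d` is at most the logarithm of the
right hand side. -/
lemma Hyp3.dist_le_log (x y : Hyp3) :
    x.dist y ≤ Real.log ((‖x.z - y.z‖ ^ 2 + x.t ^ 2 + y.t ^ 2) / (x.t * y.t)) := by
  have hxy := mul_pos x.pos y.pos
  set s := √(‖x.z - y.z‖ ^ 2 + (x.t - y.t) ^ 2) / (2 * √(x.t * y.t)) with hs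
  have hs0 : 0 ≤ s := by positivity
  have hs2 : (‖x.z - y.z‖ ^ 2 + x.t ^ 2 + y.t ^ 2) / (x.t * y.t) = 4 * s ^ 2 + 2 := by
    have := x.pos
    have := y.pos
    rw [hs, div_pow, mul_pow, Real.sq_sqrt (by positivity), Real.sq_sqrt hxy.le]
    field_simp
    ring
  have hr : 0 ≤ √(1 + s ^ 2) := Real.sqrt_nonneg _
  have hr2 : √(1 + s ^ 2) ^ 2 = 1 + s ^ 2 := Real.sq_sqrt (by positivity)
  have : x.dist y = Real.log ((s + √(1 + s ^ 2)) ^ 2) := by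
    rw [Real.log_pow]; rfl
  rw [this, hs2]
  have hpos : 0 < √(1 + s ^ 2) := Real.sqrt_pos.2 (by positivity)
  refine Real.log_le_log (by positivity) ?_
  nlinarith [sq_nonneg (s - √(1 + s ^ 2))]

namespace Frame

/-- Lagrange's identity. -/
lemma lagrange (a0 a1 b0 b1 : ℂ) :
    (a0 * star a1 + b0 * star b1) * star (a0 * star a1 + b0 * star b1)
      + (a0 * b1 - a1 * b0) * star (a0 * b1 - a1 * b0)
      = (a1 * star a1 + b1 * star b1) * (a0 * star a0 + b0 * star b0) := by
  simp only [star_add, star_sub, star_mul', star_star]; ring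

lemma norm_sq_eq (x : ℂ) : ((‖x‖ : ℂ)) ^ 2 = x * star x := (Complex.mul_conj' x).symm

/-- The ratio of two frames is `2 cosh d` for the distance `d` of their points. -/
lemma ratio_eq (X Y : Frame) (hX : X.det ≠ 0) (hY : Y.det ≠ 0) :
    (‖(X.point hX).z - (Y.point hY).z‖ ^ 2 + (X.point hX).t ^ 2 + (Y.point hY).t ^ 2) /
      ((X.point hX).t * (Y.point hY).t) = X.ratio Y := by
  have hA := norm_sq_pos hX
  have hC := norm_sq_pos hY
  have hdX : 0 < ‖X.det‖ := norm_pos_iff.2 hX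
  have hdY : 0 < ‖Y.det‖ := norm_pos_iff.2 hY
  obtain ⟨a, b⟩ := X
  obtain ⟨c, d⟩ := Y
  simp only [point, ratio] at *
  set A := ‖a 1‖ ^ 2 + ‖b 1‖ ^ 2 with hA'
  set C := ‖c 1‖ ^ 2 + ‖d 1‖ ^ 2 with hC'
  set W := a 0 * star (a 1) + b 0 * star (b 1) with hW
  set V := c 0 * star (c 1) + d 0 * star (d 1) with hV
  have hz : W / (A : ℂ) - V / (C : ℂ) = (W * C - V * A) / ((A * C : ℝ) : ℂ) := by
    have : (A : ℂ) ≠ 0 := by exact_mod_cast hA.ne'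
    have : (C : ℂ) ≠ 0 := by exact_mod_cast hC.ne'
    push_cast
    field_simp
  rw [hz, norm_div, Complex.norm_real, Real.norm_of_nonneg (by positivity)]
  have key : ‖W * C - V * A‖ ^ 2 + ‖det (a, b)‖ ^ 2 * C ^ 2 + ‖det (c, d)‖ ^ 2 * A ^ 2 =
      A * C * (‖pairing a c‖ ^ 2 + ‖pairing a d‖ ^ 2 + ‖pairing b c‖ ^ 2 + ‖pairing b d‖ ^ 2) := by
    have hAc : (A : ℂ) = a 1 * star (a 1) + b 1 * star (b 1) := by
      rw [hA']; push_cast; rw [norm_sq_eq, norm_sq_eq]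
    have hCc : (C : ℂ) = c 1 * star (c 1) + d 1 * star (d 1) := by
      rw [hC']; push_cast; rw [norm_sq_eq, norm_sq_eq]
    rw [← Complex.ofReal_inj]
    push_cast
    simp only [norm_sq_eq, hAc, hCc, det, pairing, hW, hV, star_add, star_sub, star_mul',
      star_star]
    ring
  rw [div_eq_div_iff (by positivity) (by positivity)]
  field_simp
  linear_combination key

lemma dist_point_le (X Y : Frame) (hX : X.det ≠ 0) (hY : Y.det ≠ 0) :
    (X.point hX).dist (Y.point hY) ≤ Real.log (X.ratio Y) := by
  rw [← ratio_eq X Y hX hY]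
  exact Hyp3.dist_le_log _ _

/-- The action of `SL₂(ℂ)` on frames. -/
def act (g : Matrix.SpecialLinearGroup (Fin 2) ℂ) (X : Frame) : Frame :=
  (g.1.mulVec X.1, g.1.mulVec X.2)

lemma det_act (g : Matrix.SpecialLinearGroup (Fin 2) ℂ) (X : Frame) : (X.act g).det = X.det :=
  pairing_mulVec g X.1 X.2

/-- The Poincaré extension corresponds to the linear action on frames. -/
lemma act_point (g : Matrix.SpecialLinearGroup (Fin 2) ℂ) (X : Frame) (hX : X.det ≠ 0) :
    (X.point hX).act g = (X.act g).point ((det_act g X).symm ▸ hX) := by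
  have hX' : (X.act g).det ≠ 0 := (det_act g X).symm ▸ hX
  have hA := norm_sq_pos hX
  have hA' := norm_sq_pos hX'
  have hdet := det_act g X
  obtain ⟨a, b⟩ := X
  have e1 : (act g (a, b)).1 = ![g 0 0 * a 0 + g 0 1 * a 1, g 1 0 * a 0 + g 1 1 * a 1] := by
    ext i; fin_cases i <;> simp [act]
  have e2 : (act g (a, b)).2 = ![g 0 0 * b 0 + g 0 1 * b 1, g 1 0 * b 0 + g 1 1 * b 1] := by
    ext i; fin_cases i <;> simp [act]
  simp only [e1, e2, Matrix.cons_val_zero, Matrix.cons_val_one] at hA'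
  set A := ‖a 1‖ ^ 2 + ‖b 1‖ ^ 2 with hAd
  set B := ‖g 1 0 * a 0 + g 1 1 * a 1‖ ^ 2 + ‖g 1 0 * b 0 + g 1 1 * b 1‖ ^ 2 with hBd
  set W := a 0 * star (a 1) + b 0 * star (b 1) with hW
  have hAc0 : (A : ℂ) ≠ 0 := by exact_mod_cast hA.ne'
  have hBc0 : (B : ℂ) ≠ 0 := by exact_mod_cast hA'.ne'
  have hAc : (A : ℂ) = a 1 * star (a 1) + b 1 * star (b 1) := by
    rw [hAd]; push_cast; rw [norm_sq_eq, norm_sq_eq]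
  have hBc : (B : ℂ) = (g 1 0 * a 0 + g 1 1 * a 1) * star (g 1 0 * a 0 + g 1 1 * a 1) +
      (g 1 0 * b 0 + g 1 1 * b 1) * star (g 1 0 * b 0 + g 1 1 * b 1) := by
    rw [hBd]; push_cast; rw [norm_sq_eq, norm_sq_eq]
  have hl := lagrange (a 0) (a 1) (b 0) (b 1)
  rw [← hW, ← hAc] at hl
  have hδ : (‖det (a, b)‖ : ℂ) ^ 2 = (a 0 * b 1 - a 1 * b 0) * star (a 0 * b 1 - a 1 * b 0) :=
    norm_sq_eq _
  have hsA : star (A : ℂ) = A := Complex.conj_ofReal A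
  have hden : ‖g 1 0 * (W / A) + g 1 1‖ ^ 2 + ‖g 1 0‖ ^ 2 * (‖det (a, b)‖ / A) ^ 2 = B / A := by
    rw [← Complex.ofReal_inj]
    push_cast
    rw [norm_sq_eq, norm_sq_eq, div_pow, hδ]
    simp only [star_add, star_mul', star_div₀, hsA]
    field_simp
    rw [hBc]
    simp only [star_add, star_sub, star_mul'] at hl ⊢
    rw [hW] at hl ⊢
    simp only [star_add, star_mul', star_star] at hl ⊢
    rw [hAc] at hl ⊢
    ring
  refine Hyp3.ext_coords ?_ ?_
  · change ((g 0 0 * (W / A) + g 0 1) * star (g 1 0 * (W / A) + g 1 1) +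
      g 0 0 * star (g 1 0) * ((‖det (a, b)‖ / A : ℝ) : ℂ) ^ 2) /
        ((‖g 1 0 * (W / A) + g 1 1‖ ^ 2 + ‖g 1 0‖ ^ 2 * (‖det (a, b)‖ / A) ^ 2 : ℝ) : ℂ) = _
    rw [hden]
    simp only [point, e1, e2, Matrix.cons_val_zero, Matrix.cons_val_one]
    rw [← hBd]
    push_cast
    rw [div_pow, hδ]
    simp only [star_add, star_mul', star_div₀, hsA]
    field_simp
    simp only [star_sub, star_mul'] at hl ⊢
    rw [hW]
    simp only [star_add, star_mul', star_star]
    rw [hAc]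
    ring
  · change ‖det (a, b)‖ / A /
      (‖g 1 0 * (W / A) + g 1 1‖ ^ 2 + ‖g 1 0‖ ^ 2 * (‖det (a, b)‖ / A) ^ 2) = _
    rw [hden]
    simp only [point, hdet, e1, e2, Matrix.cons_val_zero, Matrix.cons_val_one]
    rw [← hBd]
    field_simp

end Frame

/-- The translation length of `g` is bounded by the displacement of the point of a frame. -/
lemma slLength_le_log_ratio (g : Matrix.SpecialLinearGroup (Fin 2) ℂ) {X : Frame}
    (hX : X.det ≠ 0) : slLength g ≤ Real.log (X.ratio (X.act g)) := by
  refine (ciInf_le ⟨0, ?_⟩ (X.point hX)).trans ?_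
  · rintro _ ⟨x, rfl⟩
    exact Hyp3.dist_nonneg _ _
  · rw [Frame.act_point g X hX]
    exact Frame.dist_point_le _ _ _ _

lemma hypLength_nonneg (g : PSL2C) : 0 ≤ hypLength g := by
  obtain ⟨g, rfl⟩ := QuotientGroup.mk_surjective g
  exact Real.iInf_nonneg fun x => Hyp3.dist_nonneg _ _

/-! ### Exponential growth rates -/

/-- The sequence `f` grows at most like `exp (L / u)`, up to factors `exp (o(1) / u)`, where `u` is
a sequence of positive numbers which tends to zero. -/
def GrowthLE (u f : ℕ → ℝ) (L : ℝ) : Prop :=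
  ∀ ε > 0, ∀ᶠ i in atTop, f i ≤ Real.exp ((L + ε) / u i)

namespace GrowthLE

variable {u f g : ℕ → ℝ} {L M : ℝ}

lemma mono (hu : ∀ i, 0 < u i) (h : GrowthLE u f L) (hLM : L ≤ M) : GrowthLE u f M := by
  intro ε hε
  filter_upwards [h ε hε] with i hi
  exact hi.trans (Real.exp_le_exp.2 (div_le_div_of_nonneg_right (by linarith) (hu i).le))

lemma of_le (h : GrowthLE u g L) (hfg : ∀ i, f i ≤ g i) : GrowthLE u f L := by
  intro ε hε
  filter_upwards [h ε hε] with i hi using (hfg i).trans hi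

lemma mul (hg : ∀ i, 0 ≤ g i) (h : GrowthLE u f L) (h' : GrowthLE u g M) :
    GrowthLE u (fun i => f i * g i) (L + M) := by
  intro ε hε
  filter_upwards [h (ε / 2) (by positivity), h' (ε / 2) (by positivity)] with i hi hi'
  rw [show (L + M + ε) / u i = (L + ε / 2) / u i + (M + ε / 2) / u i by ring, Real.exp_add]
  exact mul_le_mul hi hi' (hg i) (Real.exp_pos _).le

lemma add (hu : ∀ i, 0 < u i) (hu0 : Tendsto u atTop (𝓝 0)) (h : GrowthLE u f L)
    (h' : GrowthLE u g L) : GrowthLE u (fun i => f i + g i) L := by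
  intro ε hε
  have hlog : 0 < Real.log 2 := Real.log_pos one_lt_two
  have h₀ : ∀ᶠ i in atTop, u i < ε / 2 / Real.log 2 :=
    hu0.eventually (gt_mem_nhds (by positivity))
  filter_upwards [h (ε / 2) (by positivity), h' (ε / 2) (by positivity), h₀] with i hi hi' hi₀
  have h₂ : 2 ≤ Real.exp (ε / 2 / u i) := by
    rw [← Real.log_le_iff_le_exp two_pos, le_div_iff₀ (hu i)]
    rw [lt_div_iff₀ hlog] at hi₀
    linarith
  rw [show (L + ε) / u i = ε / 2 / u i + (L + ε / 2) / u i by ring, Real.exp_add]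
  nlinarith [Real.exp_pos ((L + ε / 2) / u i)]

lemma of_tendsto (hu : ∀ i, 0 < u i) (hf : ∀ i, 0 < f i)
    (h : Tendsto (fun i => u i * Real.log (f i)) atTop (𝓝 L)) : GrowthLE u f L := by
  intro ε hε
  filter_upwards [h.eventually (gt_mem_nhds (show L < L + ε by linarith))] with i hi
  rw [← Real.log_le_iff_le_exp (hf i), le_div_iff₀ (hu i)]
  linarith

lemma of_eq_zero (hf : ∀ i, f i = 0) : GrowthLE u f L := fun _ _ =>
  Eventually.of_forall fun i => (hf i).le.trans (Real.exp_pos _).le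

end GrowthLE

/-! ### Degenerating ideal tetrahedra -/

section Degeneration

/-- The scaled logarithm of the determinant of the vectors which represent the vertices `j` and `k`
of an ideal tetrahedron. -/
def logPairing (u : ℕ → ℝ) (V : ℕ → Fin 4 → Fin 2 → ℂ) (j k : Fin 4) (i : ℕ) : ℝ :=
  u i * Real.log ‖pairing (V i j) (V i k)‖

/-- The numbers `c i j` describe a rescaling of the vectors `V i j`, after which the scaled logarithms
of the determinants converge to half the distances, in the dual spine, between the points where
the rays to the vertices are attached. -/
def IsGauge (q : Fin 3 → ℝ) (u : ℕ → ℝ) (V : ℕ → Fin 4 → Fin 2 → ℂ) (c : ℕ → Fin 4 → ℝ) : Prop :=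
  ∀ j k, j ≠ k → Tendsto (fun i => logPairing u V j k i - c i j - c i k) atTop
    (𝓝 (|attach q j - attach q k| / 2))

variable {u : ℕ → ℝ} {V : ℕ → Fin 4 → Fin 2 → ℂ} {q : Fin 3 → ℝ}

lemma logPairing_comm (j k : Fin 4) : logPairing u V j k = logPairing u V k j := by
  ext i; rw [logPairing, logPairing, norm_pairing_comm]

lemma isGauge_of_lt {c : ℕ → Fin 4 → ℝ}
    (h : ∀ j k, j < k → Tendsto (fun i => logPairing u V j k i - c i j - c i k) atTop
      (𝓝 (|attach q j - attach q k| / 2))) : IsGauge q u V c := by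
  intro j k hjk
  rcases hjk.lt_or_gt with hlt | hlt
  · exact h j k hlt
  · have := h k j hlt
    rw [abs_sub_comm, logPairing_comm] at this
    refine this.congr fun i => ?_
    ring

/-- The limits of the logarithms of the cross ratios determine the limits of the logarithms of the
determinants, up to rescaling. The scaling is chosen such that the determinants of the first three
vertices, and of the first and the last vertex, take their limit values. -/
lemma exists_isGauge {a : Fin 3 → ℝ}
    (ha : ∃ x : ℝ, 0 ≤ x ∧ (a = ![0, x, -x] ∨ a = ![-x, 0, x] ∨ a = ![x, -x, 0]))
    (h₀ : Tendsto (fun i => logPairing u V 0 2 i + logPairing u V 1 3 i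
      - logPairing u V 0 3 i - logPairing u V 1 2 i) atTop (𝓝 (a 0)))
    (h₁ : Tendsto (fun i => logPairing u V 0 3 i + logPairing u V 1 2 i
      - logPairing u V 0 1 i - logPairing u V 2 3 i) atTop (𝓝 (a 1))) :
    ∃ c, IsGauge (quadTriple a) u V c := by
  set A := attach (quadTriple a)
  obtain ⟨hA₀, hA₁⟩ : |A 0 - A 2| + |A 1 - A 3| - |A 0 - A 3| - |A 1 - A 2| = 2 * a 0 ∧
      |A 0 - A 3| + |A 1 - A 2| - |A 0 - A 1| - |A 2 - A 3| = 2 * a 1 := by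
    obtain ⟨x, hx, rfl | rfl | rfl⟩ := ha
    · simp only [A, quadTriple_zero hx]
      simp [attach, abs_of_nonneg hx]
      ring
    · simp only [A, quadTriple_one hx]
      simp [attach, abs_of_nonneg hx]
      ring
    · simp only [A, quadTriple_two hx]
      simp [attach, abs_of_nonneg hx]
      constructor <;> ring
  set m : Fin 4 → Fin 4 → ℕ → ℝ := fun j k i => logPairing u V j k i - |A j - A k| / 2 with hm
  set c : ℕ → Fin 4 → ℝ := fun i => ![(m 0 1 i + m 0 2 i - m 1 2 i) / 2,
    (m 0 1 i + m 1 2 i - m 0 2 i) / 2, (m 0 2 i + m 1 2 i - m 0 1 i) / 2,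
    m 0 3 i - (m 0 1 i + m 0 2 i - m 1 2 i) / 2] with hc
  have hconst {f : ℕ → ℝ} {b : ℝ} (h : ∀ i, f i = b) : Tendsto f atTop (𝓝 b) :=
    (tendsto_congr h).2 tendsto_const_nhds
  refine ⟨c, isGauge_of_lt fun j k hjk => ?_⟩
  change Tendsto _ _ (𝓝 (|A j - A k| / 2))
  obtain ⟨rfl, rfl⟩ | ⟨rfl, rfl⟩ | ⟨rfl, rfl⟩ | ⟨rfl, rfl⟩ | ⟨rfl, rfl⟩ | ⟨rfl, rfl⟩ :
      (j = 0 ∧ k = 1) ∨ (j = 0 ∧ k = 2) ∨ (j = 1 ∧ k = 2) ∨ (j = 0 ∧ k = 3) ∨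
      (j = 1 ∧ k = 3) ∨ (j = 2 ∧ k = 3) := by
    revert j k; decide
  · exact hconst fun i => by simp [hc, hm]; ring
  · exact hconst fun i => by simp [hc, hm]; ring
  · exact hconst fun i => by simp [hc, hm]; ring
  · exact hconst fun i => by simp [hc, hm]
  · refine (h₀.add_const (|A 1 - A 3| / 2 - a 0)).congr' (.of_forall fun i => ?_) |>.trans ?_
    · simp [hc, hm]; linarith
    · rw [add_sub_cancel]
  · refine ((h₁.const_sub 0).add_const (|A 2 - A 3| / 2 + a 1)).congr' (.of_forall fun i => ?_)
      |>.trans ?_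
    · simp [hc, hm]; linarith
    · rw [zero_sub, neg_add_cancel_comm_assoc]

/-- A term of `Frame.ratio`, for two frames which consist of multiples of vectors `V i j`. The
numbers `β` and `β'` are the limits of the normalised logarithmic weights of these vectors. -/
lemma growthLE_pairing {c : ℕ → Fin 4 → ℝ} (hu : ∀ i, 0 < u i)
    (hV : ∀ i j k, j ≠ k → pairing (V i j) (V i k) ≠ 0) (hc : IsGauge q u V c)
    {j k : Fin 4} {x y : ℕ → ℂ} {d d' : ℕ → ℝ} {β β' L : ℝ}
    (hx : ∀ i, x i ≠ 0) (hy : ∀ i, y i ≠ 0) (hd : ∀ i, 0 < d i) (hd' : ∀ i, 0 < d' i)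
    (hβ : Tendsto (fun i => u i * (2 * Real.log ‖x i‖ - Real.log (d i)) + 2 * c i j) atTop (𝓝 β))
    (hβ' : Tendsto (fun i => u i * (2 * Real.log ‖y i‖ - Real.log (d' i)) + 2 * c i k) atTop
      (𝓝 β'))
    (h : j ≠ k → β + β' + |attach q j - attach q k| ≤ L) :
    GrowthLE u (fun i => ‖pairing (x i • V i j) (y i • V i k)‖ ^ 2 / (d i * d' i)) L := by
  by_cases hjk : j = k
  · subst hjk
    exact .of_eq_zero fun i => by rw [pairing_smul_smul, pairing_self]; simp
  · refine GrowthLE.mono hu (.of_tendsto hu (fun i => ?_) ?_) (h hjk)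
    · have := hV i j k hjk
      have := hd i
      have := hd' i
      rw [pairing_smul_smul]
      have : 0 < ‖x i * y i * pairing (V i j) (V i k)‖ := norm_pos_iff.2
        (mul_ne_zero (mul_ne_zero (hx i) (hy i)) (hV i j k hjk))
      positivity
    · have := (hβ.add hβ').add ((hc j k hjk).const_mul 2)
      rw [mul_div_cancel₀ _ two_ne_zero] at this
      refine this.congr fun i => ?_
      have hx' := norm_ne_zero_iff.2 (hx i)
      have hy' := norm_ne_zero_iff.2 (hy i)
      have hp' := norm_ne_zero_iff.2 (hV i j k hjk)
      rw [pairing_smul_smul, norm_mul, norm_mul, Real.log_div (by positivity)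
        (mul_pos (hd i) (hd' i)).ne', Real.log_pow, Real.log_mul (by positivity) hp',
        Real.log_mul hx' hy', Real.log_mul (hd i).ne' (hd' i).ne', logPairing]
      push_cast
      ring

/-- A point on the geodesic from the ideal vertex `π 2` to the ideal vertex `π 1` of the face of a
tetrahedron opposite to the vertex `π 0`. Its signed distance, towards `π 1`, to the projection of
the third vertex `π 3` of the face is `s`. -/
def legFrame (V : Fin 4 → Fin 2 → ℂ) (s : ℝ) (π : Equiv.Perm (Fin 4)) : Frame :=
  ((Complex.exp s * pairing (V (π 2)) (V (π 3))) • V (π 1),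
    pairing (V (π 1)) (V (π 3)) • V (π 2))

lemma det_legFrame (V : Fin 4 → Fin 2 → ℂ) (s : ℝ) (π : Equiv.Perm (Fin 4)) :
    (legFrame V s π).det = Complex.exp s * pairing (V (π 2)) (V (π 3)) *
      pairing (V (π 1)) (V (π 3)) * pairing (V (π 1)) (V (π 2)) :=
  pairing_smul_smul _ _ _ _

lemma det_legFrame_ne_zero {V : Fin 4 → Fin 2 → ℂ}
    (hV : ∀ j k, j ≠ k → pairing (V j) (V k) ≠ 0) (s : ℝ) (π : Equiv.Perm (Fin 4)) :
    (legFrame V s π).det ≠ 0 := by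
  have h (a b : Fin 4) (hab : a ≠ b) := hV _ _ (π.injective.ne hab)
  rw [det_legFrame]
  exact mul_ne_zero (mul_ne_zero (mul_ne_zero (Complex.exp_ne_zero _) (h 2 3 (by decide)))
    (h 1 3 (by decide))) (h 1 2 (by decide))

lemma log_det_legFrame {V : Fin 4 → Fin 2 → ℂ}
    (hV : ∀ j k, j ≠ k → pairing (V j) (V k) ≠ 0) (s : ℝ) (π : Equiv.Perm (Fin 4)) :
    Real.log ‖(legFrame V s π).det‖ = s + Real.log ‖pairing (V (π 2)) (V (π 3))‖ +
      Real.log ‖pairing (V (π 1)) (V (π 3))‖ + Real.log ‖pairing (V (π 1)) (V (π 2))‖ := by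
  have h (a b : Fin 4) (hab : a ≠ b) := norm_ne_zero_iff.2 (hV _ _ (π.injective.ne hab))
  have h₁ := h 2 3 (by decide)
  have h₂ := h 1 3 (by decide)
  have h₃ := h 1 2 (by decide)
  rw [det_legFrame, norm_mul, norm_mul, norm_mul, Complex.norm_exp, Complex.ofReal_re,
    Real.log_mul (by positivity) h₃, Real.log_mul (by positivity) h₂,
    Real.log_mul (by positivity) h₁, Real.log_exp]

section Weights

variable {c : ℕ → Fin 4 → ℝ} (hu : ∀ i, 0 < u i)
  (hV : ∀ i j k, j ≠ k → pairing (V i j) (V i k) ≠ 0) (hq : IsQuadTriple q)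
  (hc : IsGauge q u V c)

include hu hV hq hc

/-- The limit is minus the Busemann function at `π 1` of the point of the dual spine at distance `r`
along the leg to `π 1`. -/
lemma tendsto_weight_fst (r : ℝ) (π : Equiv.Perm (Fin 4)) :
    Tendsto (fun i => u i * (2 * Real.log ‖Complex.exp ((r / u i : ℝ) : ℂ) *
        pairing (V i (π 2)) (V i (π 3))‖ - Real.log ‖(legFrame (V i) (r / u i) π).det‖)
      + 2 * c i (π 1)) atTop (𝓝 (r - |attach q (π 1) - faceCentre q (π 0)|)) := by
  have hne (a b : Fin 4) (hab : a ≠ b) : π a ≠ π b := π.injective.ne hab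
  have h₁₂ := hne 1 2 (by decide)
  have h₁₃ := hne 1 3 (by decide)
  have h₂₃ := hne 2 3 (by decide)
  have e₁ := hq.abs_add_abs (hne 1 0 (by decide)) (hne 2 0 (by decide)) h₁₂
  have e₂ := hq.abs_add_abs (hne 1 0 (by decide)) (hne 3 0 (by decide)) h₁₃
  have e₃ := hq.abs_add_abs (hne 2 0 (by decide)) (hne 3 0 (by decide)) h₂₃
  have := (((hc _ _ h₂₃).sub (hc _ _ h₁₃)).sub (hc _ _ h₁₂)).const_add r
  convert this using 2 with i
  · have := norm_ne_zero_iff.2 (hV i _ _ h₂₃)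
    have hi := (hu i).ne'
    rw [log_det_legFrame (hV i), norm_mul, Complex.norm_exp, Complex.ofReal_re,
      Real.log_mul (by positivity) this, Real.log_exp]
    simp only [logPairing]
    field_simp
    ring
  · rw [← e₁, ← e₂, ← e₃]; ring

/-- The limit is at most minus the Busemann function at `π 2` of the point of the dual spine at
distance `r` along the leg to `π 1`. -/
lemma tendsto_weight_snd (r : ℝ) (π : Equiv.Perm (Fin 4)) :
    Tendsto (fun i => u i * (2 * Real.log ‖pairing (V i (π 1)) (V i (π 3))‖
        - Real.log ‖(legFrame (V i) (r / u i) π).det‖)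
      + 2 * c i (π 2)) atTop (𝓝 (-(r + |attach q (π 2) - faceCentre q (π 0)|))) := by
  have hne (a b : Fin 4) (hab : a ≠ b) : π a ≠ π b := π.injective.ne hab
  have h₁₂ := hne 1 2 (by decide)
  have h₁₃ := hne 1 3 (by decide)
  have h₂₃ := hne 2 3 (by decide)
  have e₁ := hq.abs_add_abs (hne 1 0 (by decide)) (hne 2 0 (by decide)) h₁₂
  have e₂ := hq.abs_add_abs (hne 1 0 (by decide)) (hne 3 0 (by decide)) h₁₃
  have e₃ := hq.abs_add_abs (hne 2 0 (by decide)) (hne 3 0 (by decide)) h₂₃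
  have := (((hc _ _ h₁₃).sub (hc _ _ h₂₃)).sub (hc _ _ h₁₂)).const_add (-r)
  convert this using 2 with i
  · have hi := (hu i).ne'
    rw [log_det_legFrame (hV i)]
    simp only [logPairing]
    field_simp
    ring
  · rw [← e₁, ← e₂, ← e₃]; ring

/-- The distances in the dual spine are upper bounds for the scaled limits of the hyperbolic distances
of the corresponding points on the ideal tetrahedra. -/
lemma growthLE_legFrame (hu0 : Tendsto u atTop (𝓝 0)) {x y : Spine q} {r s : ℝ}
    {π π' : Equiv.Perm (Fin 4)} (hx : x.OnLeg (π 0) (π 1) r) (hy : y.OnLeg (π' 0) (π' 1) s) :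
    GrowthLE u (fun i => (legFrame (V i) (r / u i) π).ratio (legFrame (V i) (s / u i) π'))
      (x.dist y) := by
  have hne (π : Equiv.Perm (Fin 4)) (a b : Fin 4) (hab : a ≠ b) : π a ≠ π b := π.injective.ne hab
  have hd (r : ℝ) (π : Equiv.Perm (Fin 4)) (i : ℕ) : 0 < ‖(legFrame (V i) (r / u i) π).det‖ :=
    norm_pos_iff.2 (det_legFrame_ne_zero (hV i) _ _)
  have hn (π : Equiv.Perm (Fin 4)) (t : ℕ → ℝ) (i : ℕ) :
      Complex.exp (t i : ℂ) * pairing (V i (π 2)) (V i (π 3)) ≠ 0 :=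
    mul_ne_zero (Complex.exp_ne_zero _) (hV i _ _ (hne π 2 3 (by decide)))
  have hf (π : Equiv.Perm (Fin 4)) (i : ℕ) : pairing (V i (π 1)) (V i (π 3)) ≠ 0 :=
    hV i _ _ (hne π 1 3 (by decide))
  have w₁ := tendsto_weight_fst hu hV hq hc r π
  have w₂ := tendsto_weight_snd hu hV hq hc r π
  have w₁' := tendsto_weight_fst hu hV hq hc s π'
  have w₂' := tendsto_weight_snd hu hV hq hc s π'
  have b₁ := hx.busemann_eq
  have b₂ := hx.busemann_le (hne π 1 2 (by decide))
  have b₁' := hy.busemann_eq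
  have b₂' := hy.busemann_le (hne π' 1 2 (by decide))
  have tri {j k : Fin 4} (h : j ≠ k) := Spine.abs_attach_sub_le x y h
  have t₁₁ := growthLE_pairing hu hV hc (hn π _) (hn π' _) (hd r π) (hd s π') w₁ w₁'
    (L := x.dist y) fun h => by linarith [tri h]
  have t₁₂ := growthLE_pairing hu hV hc (hn π _) (hf π') (hd r π) (hd s π') w₁ w₂'
    (L := x.dist y) fun h => by linarith [tri h]
  have t₂₁ := growthLE_pairing hu hV hc (hf π) (hn π' _) (hd r π) (hd s π') w₂ w₁'
    (L := x.dist y) fun h => by linarith [tri h]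
  have t₂₂ := growthLE_pairing hu hV hc (hf π) (hf π') (hd r π) (hd s π') w₂ w₂'
    (L := x.dist y) fun h => by linarith [tri h]
  refine (((t₁₁.add hu hu0 t₁₂).add hu hu0 t₂₁).add hu hu0 t₂₂).of_le fun i => le_of_eq ?_
  rw [Frame.ratio, add_div, add_div, add_div]
  rfl

end Weights

end Degeneration

/-! ### The coordinates of an ideal point -/

/-- If `x ≤ y + z`, then the growth rate of `x` is at most the larger of those of `y` and `z`. -/
lemma le_max_of_tendsto {u x y z : ℕ → ℝ} {α β δ : ℝ} (hu : ∀ i, 0 < u i)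
    (hu0 : Tendsto u atTop (𝓝 0)) (hx : ∀ i, 0 < x i) (hy : ∀ i, 0 < y i) (hz : ∀ i, 0 < z i)
    (h : ∀ i, x i ≤ y i + z i)
    (hα : Tendsto (fun i => u i * Real.log (x i)) atTop (𝓝 α))
    (hβ : Tendsto (fun i => u i * Real.log (y i)) atTop (𝓝 β))
    (hδ : Tendsto (fun i => u i * Real.log (z i)) atTop (𝓝 δ)) : α ≤ max β δ := by
  have := (hu0.mul_const (Real.log 2)).add (hβ.max hδ)
  rw [zero_mul, zero_add] at this
  refine le_of_tendsto_of_tendsto' hα this fun i => ?_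
  rw [← mul_max_of_nonneg _ _ (hu i).le, ← mul_add]
  refine mul_le_mul_of_nonneg_left ?_ (hu i).le
  rcases le_total (y i) (z i) with hyz | hyz
  · rw [max_eq_right (Real.log_le_log (hy i) hyz), ← Real.log_mul two_ne_zero (hz i).ne']
    exact Real.log_le_log (hx i) ((h i).trans (by linarith))
  · rw [max_eq_left (Real.log_le_log (hz i) hyz), ← Real.log_mul two_ne_zero (hy i).ne']
    exact Real.log_le_log (hx i) ((h i).trans (by linarith))

/-- The logarithmic limits of the coordinates of points on the line `z + 1 / w = 1` lie on a tropical
line. -/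
lemma tropical_line {u : ℕ → ℝ} {z w : ℕ → ℂ} {α β : ℝ} (hu : ∀ i, 0 < u i)
    (hu0 : Tendsto u atTop (𝓝 0)) (hz : ∀ i, z i ≠ 0) (hw : ∀ i, w i ≠ 0)
    (h : ∀ i, w i * (1 - z i) = 1)
    (hα : Tendsto (fun i => u i * Real.log ‖z i‖) atTop (𝓝 α))
    (hβ : Tendsto (fun i => u i * Real.log ‖w i‖) atTop (𝓝 β)) :
    α ≤ max 0 (-β) ∧ -β ≤ max 0 α ∧ 0 ≤ max α (-β) := by
  have h' (i : ℕ) : z i = 1 - (w i)⁻¹ := by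
    have := hw i
    field_simp
    linear_combination -h i
  have hz' (i : ℕ) : 0 < ‖z i‖ := norm_pos_iff.2 (hz i)
  have hw' (i : ℕ) : 0 < ‖(w i)⁻¹‖ := norm_pos_iff.2 (inv_ne_zero (hw i))
  have h1 (_ : ℕ) : (0 : ℝ) < 1 := one_pos
  have l1 : Tendsto (fun i => u i * Real.log 1) atTop (𝓝 0) := by simp
  have lw : Tendsto (fun i => u i * Real.log ‖(w i)⁻¹‖) atTop (𝓝 (-β)) := by
    refine hβ.neg.congr fun i => ?_
    rw [norm_inv, Real.log_inv, mul_neg]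
  refine ⟨le_max_of_tendsto hu hu0 hz' h1 hw' (fun i => ?_) hα l1 lw,
    le_max_of_tendsto hu hu0 hw' h1 hz' (fun i => ?_) lw l1 hα,
    le_max_of_tendsto hu hu0 h1 hz' hw' (fun i => ?_) l1 hα lw⟩
  · rw [h']
    exact (norm_sub_le _ _).trans_eq (by rw [norm_one])
  · rw [show (w i)⁻¹ = 1 - z i by rw [h']; ring]
    exact (norm_sub_le _ _).trans_eq (by rw [norm_one])
  · calc (1 : ℝ) = ‖z i + (w i)⁻¹‖ := by rw [h', sub_add_cancel, norm_one]
      _ ≤ _ := norm_add_le _ _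

/-- The three parameter equations put three pairs of the entries of the limit on tropical lines, which
leaves only the three rays of the claim. -/
lemma exists_triple {u : ℕ → ℝ} {z : ℕ → Fin 3 → ℂ} {a : Fin 3 → ℝ} (hu : ∀ i, 0 < u i)
    (hu0 : Tendsto u atTop (𝓝 0)) (hz : ∀ i m, z i m ≠ 0)
    (h : ∀ i, z i 0 * (1 - z i 2) = 1 ∧ z i 1 * (1 - z i 0) = 1 ∧ z i 2 * (1 - z i 1) = 1)
    (ha : ∀ m, Tendsto (fun i => u i * Real.log ‖z i m‖) atTop (𝓝 (a m))) :
    ∃ x : ℝ, 0 ≤ x ∧ (a = ![0, x, -x] ∨ a = ![-x, 0, x] ∨ a = ![x, -x, 0]) := by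
  have t (k m : Fin 3) (hkm : ∀ i, z i m * (1 - z i k) = 1) :=
    tropical_line hu hu0 (fun i => hz i k) (fun i => hz i m) hkm (ha k) (ha m)
  obtain ⟨p₁, p₂, p₃⟩ := t 0 1 fun i => (h i).2.1
  obtain ⟨q₁, q₂, q₃⟩ := t 1 2 fun i => (h i).2.2
  obtain ⟨r₁, r₂, r₃⟩ := t 2 0 fun i => (h i).1
  have ext {x y w : ℝ} (h₀ : a 0 = x) (h₁ : a 1 = y) (h₂ : a 2 = w) : a = ![x, y, w] := by
    ext m; fin_cases m <;> assumption
  rw [le_max_iff] at p₁ p₂ p₃ q₁ q₂ q₃ r₁ r₂ r₃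
  rcases lt_trichotomy (a 0) 0 with h₀ | h₀ | h₀
  · refine ⟨-a 0, by linarith, .inr (.inl (ext (by ring) ?_ ?_))⟩ <;> grind
  · refine ⟨a 1, ?_, .inl (ext h₀ rfl ?_)⟩ <;> grind
  · refine ⟨a 0, h₀.le, .inr (.inr (ext rfl ?_ ?_))⟩ <;> grind

lemma IsQuadTriple.of_triple {a : Fin 3 → ℝ}
    (ha : ∃ x : ℝ, 0 ≤ x ∧ (a = ![0, x, -x] ∨ a = ![-x, 0, x] ∨ a = ![x, -x, 0])) :
    IsQuadTriple (quadTriple a) := by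
  obtain ⟨x, hx, rfl | rfl | rfl⟩ := ha
  · exact ⟨x, hx, .inl (quadTriple_zero hx)⟩
  · exact ⟨x, hx, .inr (.inl (quadTriple_one hx))⟩
  · exact ⟨x, hx, .inr (.inr (quadTriple_two hx))⟩

lemma scaleFactor_pos {n : ℕ} (Z : Fin n × Fin 3 → ℂ) : 0 < scaleFactor Z := by
  unfold scaleFactor; positivity

lemma scaleFactor_sq {n : ℕ} (Z : Fin n × Fin 3 → ℂ) :
    scaleFactor Z ^ 2 = 1 - ‖scaleFactor Z • logAbs Z‖ ^ 2 := by
  have hS : 0 < 1 + ∑ j, (Real.log ‖Z j‖) ^ 2 := by positivity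
  have h : ‖logAbs Z‖ ^ 2 = ∑ j, (Real.log ‖Z j‖) ^ 2 := EuclideanSpace.real_norm_sq_eq _
  rw [norm_smul, mul_pow, h, Real.norm_of_nonneg (scaleFactor_pos Z).le, scaleFactor, div_pow,
    Real.sq_sqrt hS.le]
  field_simp
  ring

/-- As `u(Z)² = 1 - ‖u(Z) log |Z|‖²`, the scaling factors tend to zero at an ideal point. -/
lemma tendsto_scaleFactor {n : ℕ} {Z : ℕ → Fin n × Fin 3 → ℂ}
    {ξ : EuclideanSpace ℝ (Fin n × Fin 3)} (hξ : ‖ξ‖ = 1)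
    (h : Tendsto (fun i => scaleFactor (Z i) • logAbs (Z i)) atTop (𝓝 ξ)) :
    Tendsto (fun i => scaleFactor (Z i)) atTop (𝓝 0) := by
  have h₁ := (((h.norm).pow 2).const_sub 1).sqrt
  rw [hξ, one_pow, sub_self, Real.sqrt_zero] at h₁
  refine h₁.congr fun i => ?_
  rw [← scaleFactor_sq, Real.sqrt_sq (scaleFactor_pos _).le]

lemma tendsto_coord {n : ℕ} {Z : ℕ → Fin n × Fin 3 → ℂ} {ξ : EuclideanSpace ℝ (Fin n × Fin 3)}
    (h : Tendsto (fun i => scaleFactor (Z i) • logAbs (Z i)) atTop (𝓝 ξ)) (j : Fin n × Fin 3) :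
    Tendsto (fun i => scaleFactor (Z i) * Real.log ‖Z i j‖) atTop (𝓝 (ξ j)) :=
  ((EuclideanSpace.proj (𝕜 := ℝ) j).continuous.tendsto ξ).comp h

/-! ### Developing maps -/

section Developing

universe u

variable {n : ℕ} {T : IdealTriangulation n} {E : Type u} [TopologicalSpace E]
  {p : E → T.Manifold}

namespace DevelopingMap

section Single

variable {Z : Fin n × Fin 3 → ℂ} (D : DevelopingMap T p Z)

/-- Vectors of `ℂ²` which represent the ideal vertices of the image of a lifted tetrahedron. -/
def vec (σ : LiftedTet T p) (v : Fin 4) : Fin 2 → ℂ := (D.vertex σ v).rep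

lemma pairing_vec_ne_zero (σ : LiftedTet T p) (j k : Fin 4) (h : j ≠ k) :
    pairing (D.vec σ j) (D.vec σ k) ≠ 0 :=
  pairing_rep_ne_zero ((D.injective σ).ne h)

/-- The points `legFrame` on a common face of two tetrahedra coincide. -/
lemma legFrame_adj {σ τ : LiftedTet T p} (s : ℝ) (π : Equiv.Perm (Fin 4))
    (h : σ.Adj (π 0) τ) :
    legFrame (D.vec τ) s (T.gluing σ.idx (π 0) * π) = legFrame (D.vec σ) s π := by
  have hv (a : Fin 4) (ha : a ≠ 0) :
      D.vec τ ((T.gluing σ.idx (π 0) * π) a) = D.vec σ (π a) :=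
    congrArg Projectivization.rep (D.face σ (π 0) τ h (π a) (π.injective.ne ha))
  simp only [legFrame, hv 1 (by decide), hv 2 (by decide), hv 3 (by decide)]

lemma exists_rep_eq_smul_mulVec (g : Matrix.SpecialLinearGroup (Fin 2) ℂ) (P : SphereAtInfinity) :
    ∃ k : ℂ, k ≠ 0 ∧ ((g : PSL2C) • P).rep = k • g.1.mulVec P.rep := by
  have hP : g.1.mulVec P.rep ≠ 0 := by
    intro h
    refine P.rep_nonzero ?_
    have : (g⁻¹).1.mulVec (g.1.mulVec P.rep) = P.rep := by
      rw [Matrix.mulVec_mulVec, ← Matrix.SpecialLinearGroup.coe_mul, inv_mul_cancel,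
        Matrix.SpecialLinearGroup.coe_one, Matrix.one_mulVec]
    rw [← this, h, Matrix.mulVec_zero]
  have h : (g : PSL2C) • P = Projectivization.mk ℂ (g.1.mulVec P.rep) hP := by
    conv_lhs => rw [← P.mk_rep]
    rfl
  obtain ⟨k, hk⟩ := Projectivization.exists_smul_eq_mk_rep ℂ _ hP
  exact ⟨k, k.ne_zero, by rw [h, ← hk]; rfl⟩

/-- The translation length of `rep γ` is at most the displacement of the points `legFrame`, which
are equivariant. -/
lemma hypLength_le (γ : DeckGroup p) (σ : LiftedTet T p) (s : ℝ) (π : Equiv.Perm (Fin 4)) :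
    hypLength (D.rep γ) ≤
      Real.log ((legFrame (D.vec σ) s π).ratio (legFrame (D.vec (σ.deck γ)) s π)) := by
  obtain ⟨g, hg⟩ := QuotientGroup.mk_surjective (D.rep γ)
  have hv (v : Fin 4) : ∃ k : ℂ, k ≠ 0 ∧ D.vec (σ.deck γ) v = k • g.1.mulVec (D.vec σ v) := by
    rw [vec, D.equivariant, ← hg]
    exact exists_rep_eq_smul_mulVec g _
  choose k hk0 hk using hv
  set X := legFrame (D.vec σ) s π
  have hX : X.det ≠ 0 := det_legFrame_ne_zero (D.pairing_vec_ne_zero σ) s π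
  have h : legFrame (D.vec (σ.deck γ)) s π =
      ((k (π 1) * k (π 2) * k (π 3)) • (X.act g).1, (k (π 1) * k (π 2) * k (π 3)) • (X.act g).2) := by
    simp only [X, legFrame, Frame.act, hk, pairing_smul_smul, pairing_mulVec, Matrix.mulVec_smul,
      smul_smul]
    congr 2 <;> ring
  rw [h, Frame.ratio_smul_right _ _ _ (mul_ne_zero (mul_ne_zero (hk0 _) (hk0 _)) (hk0 _)), ← hg]
  exact slLength_le_log_ratio g hX

end Single

variable {Z : ℕ → Fin n × Fin 3 → ℂ} {ξ : EuclideanSpace ℝ (Fin n × Fin 3)}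

lemma exists_isGauge_vec (D : ∀ i, DevelopingMap T p (Z i))
    (h : Tendsto (fun i => scaleFactor (Z i) • logAbs (Z i)) atTop (𝓝 ξ)) (σ : LiftedTet T p)
    (ha : ∃ x : ℝ, 0 ≤ x ∧ ((fun m => ξ (σ.idx, m)) = ![0, x, -x] ∨
      (fun m => ξ (σ.idx, m)) = ![-x, 0, x] ∨ (fun m => ξ (σ.idx, m)) = ![x, -x, 0])) :
    ∃ c, IsGauge (quadCoord ξ σ.idx) (fun i => scaleFactor (Z i)) (fun i => (D i).vec σ) c := by
  have hne (i : ℕ) (j k : Fin 4) (hjk : j ≠ k) : ‖pairing ((D i).vec σ j) ((D i).vec σ k)‖ ≠ 0 :=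
    norm_ne_zero_iff.2 ((D i).pairing_vec_ne_zero σ j k hjk)
  have hlog (i : ℕ) (a b c d : Fin 4) (hac : a ≠ c) (hbd : b ≠ d) (had : a ≠ d) (hbc : b ≠ c) :
      Real.log ‖crossRatio ((D i).vertex σ a) ((D i).vertex σ b) ((D i).vertex σ c)
        ((D i).vertex σ d)‖ = Real.log ‖pairing ((D i).vec σ a) ((D i).vec σ c)‖
        + Real.log ‖pairing ((D i).vec σ b) ((D i).vec σ d)‖
        - Real.log ‖pairing ((D i).vec σ a) ((D i).vec σ d)‖
        - Real.log ‖pairing ((D i).vec σ b) ((D i).vec σ c)‖ := by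
    have h₁ := hne i a c hac
    have h₂ := hne i b d hbd
    have h₃ := hne i a d had
    have h₄ := hne i b c hbc
    simp only [crossRatio, bracket_eq_pairing, norm_div, norm_mul]
    change Real.log (‖pairing ((D i).vec σ a) ((D i).vec σ c)‖
      * ‖pairing ((D i).vec σ b) ((D i).vec σ d)‖
      / (‖pairing ((D i).vec σ a) ((D i).vec σ d)‖
      * ‖pairing ((D i).vec σ b) ((D i).vec σ c)‖)) = _
    rw [Real.log_div (mul_ne_zero h₁ h₂) (mul_ne_zero h₃ h₄), Real.log_mul h₁ h₂,
      Real.log_mul h₃ h₄]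
    ring
  refine exists_isGauge ha ?_ ?_
  · refine (tendsto_coord h (σ.idx, 0)).congr fun i => ?_
    rw [← ((D i).shape σ).1, hlog i 0 1 2 3 (by decide) (by decide) (by decide) (by decide)]
    simp only [logPairing]
    ring
  · refine (tendsto_coord h (σ.idx, 1)).congr fun i => ?_
    rw [← ((D i).shape σ).2.1, hlog i 0 2 3 1 (by decide) (by decide) (by decide) (by decide),
      norm_pairing_comm ((D i).vec σ 2) ((D i).vec σ 1)]
    simp only [logPairing]
    ring

/-- The lengths of paths in the leaf space are upper bounds for the scaled limits of the
hyperbolic distances between the points on the images of the ideal tetrahedra which correspond to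
the ends of the path. -/
lemma growthLE_of_leafPath (D : ∀ i, DevelopingMap T p (Z i)) {u : ℕ → ℝ} (hu : ∀ i, 0 < u i)
    (hu0 : Tendsto u atTop (𝓝 0)) {N : Fin n → Fin 3 → ℝ} (hN : ∀ i, IsQuadTriple (N i))
    (hc : ∀ σ : LiftedTet T p, ∃ c, IsGauge (N σ.idx) u (fun i => (D i).vec σ) c)
    {x y : SpineUnion T p N} {L : ℝ} (hL : x.LeafPath y L) {r s : ℝ} {π π' : Equiv.Perm (Fin 4)}
    (hx : x.pt.OnLeg (π 0) (π 1) r) (hy : y.pt.OnLeg (π' 0) (π' 1) s) :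
    GrowthLE u (fun i => (legFrame ((D i).vec x.tet) (r / u i) π).ratio
      (legFrame ((D i).vec y.tet) (s / u i) π')) L := by
  have hsame (σ : LiftedTet T p) {a b : Spine (N σ.idx)} {r s : ℝ} {π π' : Equiv.Perm (Fin 4)}
      (ha : a.OnLeg (π 0) (π 1) r) (hb : b.OnLeg (π' 0) (π' 1) s) :
      GrowthLE u (fun i => (legFrame ((D i).vec σ) (r / u i) π).ratio
        (legFrame ((D i).vec σ) (s / u i) π')) (a.dist b) :=
    growthLE_legFrame hu (fun i => (D i).pairing_vec_ne_zero σ) (hN _) (hc σ).choose_spec hu0 ha hb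
  have hperm {f w : Fin 4} (h : w ≠ f) : ∃ π : Equiv.Perm (Fin 4), π 0 = f ∧ π 1 = w := by
    revert f w; decide
  have htrans {X Y W : ℕ → Frame} {K L : ℝ} (hY : ∀ i, (Y i).det ≠ 0)
      (h₁ : GrowthLE u (fun i => (X i).ratio (Y i)) K)
      (h₂ : GrowthLE u (fun i => (Y i).ratio (W i)) L) :
      GrowthLE u (fun i => (X i).ratio (W i)) (K + L) :=
    (h₁.mul (fun i => Frame.ratio_nonneg _ _) h₂).of_le fun i => Frame.ratio_le_mul _ _ (hY i)
  have hdet (σ : LiftedTet T p) (s : ℕ → ℝ) (π : Equiv.Perm (Fin 4)) (i : ℕ) :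
      (legFrame ((D i).vec σ) (s i) π).det ≠ 0 :=
    det_legFrame_ne_zero ((D i).pairing_vec_ne_zero σ) _ _
  induction hL generalizing r π with
  | nil x =>
    have := hsame x.tet hx hy
    rwa [Spine.dist_self] at this
  | move σ a b _ ih =>
    obtain ⟨f, w, t, hwf, hb⟩ := Spine.exists_onLeg (hN _) b
    obtain ⟨κ, rfl, rfl⟩ := hperm hwf
    exact htrans (hdet σ _ κ) (hsame σ hx hb) (ih hb hy)
  | @glue x x' y L hg _ ih =>
    -- a point of the common face which represents both `x` and `x'`
    obtain ⟨t, κ, κ', hκ, hκ', hF⟩ : ∃ (t : ℝ) (κ κ' : Equiv.Perm (Fin 4)),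
        x.pt.OnLeg (κ 0) (κ 1) t ∧ x'.pt.OnLeg (κ' 0) (κ' 1) t ∧
        ∀ i, legFrame ((D i).vec x.tet) (t / u i) κ = legFrame ((D i).vec x'.tet) (t / u i) κ' := by
      rcases hg with ⟨f, hadj, w, hwf, t, h, h'⟩ | ⟨f, hadj, w, hwf, t, h, h'⟩
      · obtain ⟨κ, rfl, rfl⟩ := hperm hwf
        exact ⟨t, κ, _ * κ, h, h', fun i => ((D i).legFrame_adj _ κ hadj).symm⟩
      · obtain ⟨κ, rfl, rfl⟩ := hperm hwf
        exact ⟨t, _ * κ, κ, h', h, fun i => (D i).legFrame_adj _ κ hadj⟩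
    have h₁ := hsame x.tet hx hκ
    rw [Spine.dist_self] at h₁
    simp only [hF] at h₁
    have h₂ := htrans (hdet x'.tet _ κ') h₁ (ih hκ' hy)
    rwa [zero_add] at h₂

/-- The length of a path from `x` to `γ x` bounds the scaled translation lengths, up to `o(1)`. -/
lemma eventually_hypLength_le (D : ∀ i, DevelopingMap T p (Z i)) {u : ℕ → ℝ} (hu : ∀ i, 0 < u i)
    (hu0 : Tendsto u atTop (𝓝 0)) {N : Fin n → Fin 3 → ℝ} (hN : ∀ i, IsQuadTriple (N i))
    (hc : ∀ σ : LiftedTet T p, ∃ c, IsGauge (N σ.idx) u (fun i => (D i).vec σ) c)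
    (γ : DeckGroup p) {x : SpineUnion T p N} {L : ℝ} (hL : x.LeafPath (x.deck γ) L)
    {ε : ℝ} (hε : 0 < ε) : ∀ᶠ i in atTop, u i * hypLength ((D i).rep γ) ≤ L + ε := by
  obtain ⟨f, w, t, hwf, hx⟩ := Spine.exists_onLeg (hN _) x.pt
  obtain ⟨π, rfl, rfl⟩ : ∃ π : Equiv.Perm (Fin 4), π 0 = f ∧ π 1 = w := by
    clear hx
    revert f w; decide
  filter_upwards [growthLE_of_leafPath D hu hu0 hN hc hL hx (y := x.deck γ) hx ε hε] with i hi
  rw [mul_comm, ← le_div_iff₀ (hu i)]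
  refine ((D i).hypLength_le γ x.tet (t / u i) π).trans ?_
  rcases (Frame.ratio_nonneg (legFrame ((D i).vec x.tet) (t / u i) π)
    (legFrame ((D i).vec (x.tet.deck γ)) (t / u i) π)).eq_or_lt with h | h
  -- a vanishing ratio does not occur, but its junk logarithm `0` satisfies the bound as well
  · rw [← h, Real.log_zero]
    exact div_nonneg (add_nonneg hL.nonneg hε.le) (hu i).le
  · exact (Real.log_le_iff_le_exp h).2 hi

end DevelopingMap

end Developing

end

theorem proposition6p6 {n : ℕ} (T : IdealTriangulation n) [ConnectedSpace T.Manifold]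
    {E : Type*} [TopologicalSpace E] [SimplyConnectedSpace E] (p : E → T.Manifold)
    (hp : IsCoveringMap p)
    (ξ : EuclideanSpace ℝ (Fin n × Fin 3)) (hξ : ξ ∈ T.idealPoints)
    (Z : ℕ → Fin n × Fin 3 → ℂ) (hZ : ∀ i, Z i ∈ T.deformationVariety)
    (hlim : StronglyConverges Z ξ)
    (D : ∀ i, DevelopingMap T p (Z i)) (γ : DeckGroup p) :
    (∃ φ : ℕ → ℕ, StrictMono φ ∧ ∃ l : ℝ,
      Tendsto (fun i => scaleFactor (Z (φ i)) * hypLength ((D (φ i)).rep γ)) atTop (𝓝 l)) ∧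
    treeLength (quadCoord ξ) γ ≠ ⊤ ∧
    ∀ φ : ℕ → ℕ, StrictMono φ → ∀ l : ℝ,
      Tendsto (fun i => scaleFactor (Z (φ i)) * hypLength ((D (φ i)).rep γ)) atTop (𝓝 l) →
      0 ≤ l ∧ l ≤ (treeLength (quadCoord ξ) γ).toReal := by
  have hu (i : ℕ) := scaleFactor_pos (Z i)
  have hu0 := tendsto_scaleFactor (mem_sphere_zero_iff_norm.1 hξ.1) hlim.1
  have htriple (j : Fin n) := exists_triple (z := fun i m => Z i (j, m)) hu hu0
    (fun i m => (hZ i).1 (j, m)) (fun i => (hZ i).2.1 j) fun m => tendsto_coord hlim.1 (j, m)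
  have hN (j : Fin n) : IsQuadTriple (quadCoord ξ j) := .of_triple (htriple j)
  have hc (σ : LiftedTet T p) := DevelopingMap.exists_isGauge_vec D hlim.1 σ (htriple σ.idx)
  have hfin : treeLength (quadCoord ξ) γ ≠ ⊤ := treeLength_ne_top hN hp γ
  have hnonneg (i : ℕ) : 0 ≤ scaleFactor (Z i) * hypLength ((D i).rep γ) :=
    mul_nonneg (hu i).le (hypLength_nonneg _)
  refine ⟨?_, hfin, fun φ hφ l hl => ⟨ge_of_tendsto' hl fun i => hnonneg _, ?_⟩⟩
  · obtain ⟨σ, -⟩ := LiftedTet.exists_mem_range hp (Classical.arbitrary E)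
    set x : SpineUnion T p (quadCoord ξ) := ⟨σ, .axis 0 le_rfl (hN σ.idx).axisLength_nonneg⟩
    obtain ⟨L, hL⟩ := SpineUnion.exists_leafPath hN hp x (x.deck γ)
    obtain ⟨l, -, φ, hφ, hl⟩ := tendsto_subseq_of_frequently_bounded
      (x := fun i => scaleFactor (Z i) * hypLength ((D i).rep γ)) (Metric.isBounded_Icc 0 (L + 1))
      ((DevelopingMap.eventually_hypLength_le D hu hu0 hN hc γ hL one_pos).mono
        fun i hi => ⟨hnonneg i, hi⟩).frequently
    exact ⟨φ, hφ, l, hl⟩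
  · rw [← ENNReal.ofReal_le_iff_le_toReal hfin]
    refine le_treeLength fun x L hL => le_of_forall_pos_le_add fun ε hε => ?_
    exact le_of_tendsto hl (hφ.tendsto_atTop.eventually
      (DevelopingMap.eventually_hypLength_le D hu hu0 hN hc γ hL hε))
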